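/- Let $\mathbb T$ be one of $\{0,\dots,T\}$ (with $T\in\mathbb N_0$), $\mathbb N_0$, or $\mathbb N_0\cup\{\infty\}$, and let $\mathbb T_t=\{s\in\mathbb T: s\ge t\}$. Let $(\Omega,\mathcal F,(\mathcal F_t)_{t\in\mathbb T\cap\mathbb N_0},P)$ be a filtered probability space with $\mathcal F_0=\{\emptyset,\Omega\}$, and put $\mathcal F_\infty=\sigma(\bigcup_n\mathcal F_n)$. Let $\mathcal R^\infty$ be the set of adapted processes $X=(X_t)_{t\in\mathbb T}$ such that $\sup_{t\in\mathbb T}|X_t|$ is $P$-essentially bounded, and let $\mathcal R_t^\infty$ be the set of processes $X1_{\mathbb T_t}$, $X\in\mathcal R^\infty$. Processes and random variables are identified when they agree $P$-a.s., and (in)equalities between them are understood $P$-a.s. unless another measure is named. A *dynamic convex risk measure for processes* is a family of maps $\rho_t:\mathcal R^\infty_t\to L^\infty(\Omega,\mathcal F_t,P)$, $t\in\mathbb T\cap\mathbb N_0$, such that for all $X,Y\in\mathcal R_t^\infty$: $\rho_t(X+m1_{\mathbb T_t})=\rho_t(X)-m$ for $m\in L^\infty(\mathcal F_t)$; $X\le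 Y$ implies $\rho_t(X)\ge\rho_t(Y)$; $\rho_t(\lambda X+(1-\lambda)Y)\le\lambda\rho_t(X)+(1-\lambda)\rho_t(Y)$ for $\lambda\in L^\infty(\mathcal F_t)$ with $0\le\lambda\le1$; and $\rho_t(0)=0$. For $X\in\mathcal R^\infty$ write $\rho_t(X)=\rho_t(X1_{\mathbb T_t})$. Fix such a family which is *time consistent*, i.e. for all $t\in\mathbb N_0$ with $t+1\in\mathbb T$ and all $X,Y\in\mathcal R^\infty$, $X_t=Y_t$ and $\rho_{t+1}(X)\le\rho_{t+1}(Y)$ imply $\rho_t(X)\le\rho_t(Y)$, and such that each $\rho_t$ is *continuous from above*, i.e. $\rho_t(X^n)\nearrow\rho_t(X)$ $P$-a.s. for every decreasing sequence $(X^n)$ in $\mathcal R^\infty$ and $X\in\mathcal R^\infty$ with $X^n_s\searrow X_s$ $P$-a.s. for all $s\in\mathbb T_t$. Let $Q$ be a probability measure on $(\Omega,\mathcal F)$ with $Q\ll P$ on $\mathcal F_t$ for all $t\in\mathbb T\cap\mathbb N_0$, and let $D=(D_t)_{t\in\mathbb T}$ be a discounting process for $Q$: $D_t$ is $\mathcal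 F_{t-1}$-measurable for finite $t\ge1$, $D_\infty$ (if $\infty\in\mathbb T$) is $\mathcal F_\infty$-measurable, and $Q$-a.s. $D$ is nonnegative and non-increasing with $D_0=1$; moreover $\lim_{t\to\infty}D_t=0$ $Q$-a.s. if $\mathbb T=\mathbb N_0$, while if $\mathbb T=\mathbb N_0\cup\{\infty\}$, then $\lim_{t\to\infty}D_t=D_\infty$ $Q$-a.s., and $D_\infty=0$ $Q$-a.s. on $\{\lim_{t\to\infty}M_t=\infty\}$, where $M_t=\frac{dQ}{dP}\big|_{\mathcal F_t}$. Put $\gamma_t=D_t-D_{t+1}$ for $t\in\mathbb T\cap\mathbb N_0$ (with $D_{T+1}:=0$ if $\mathbb T=\{0,\dots,T\}$) and $\gamma_\infty=D_\infty$ if $\infty\in\mathbb T$. Let $Q\otimes D$ be the measure on the $\sigma$-field $\bar{\mathcal F}$ on $\Omega\times\mathbb T$ generated by the sets $A\times\{t\}$, $t\in\mathbb T$, $A\in\mathcal F_t$, given by $E_{Q\otimes D}[X]=E_Q[\sum_{t\in\mathbb T}\gamma_tX_t]$. Assume that $Q\otimes D\in\mathcal M(\bar P)$, i.e. that it is a probability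 measure absolutely continuous with respect to $\bar P$, where $E_{\bar P}[X]=E_P[\sum_{t\in\mathbb T}\mu_tX_t]$ for a fixed adapted process $\mu>0$ with $\sum_{t\in\mathbb T}\mu_t=1$. For $t\in\mathbb T\cap\mathbb N_0$ let $$\alpha_t(Q\otimes D)=Q\text{-}\operatorname*{ess\,sup}_{X\in\mathcal R_t^\infty,\ \rho_t(X)\le0}E_Q\Big[-\sum_{s\in\mathbb T_t}\frac{\gamma_s}{D_t}X_s\,\Big|\,\mathcal F_t\Big]\ \text{ on }\{D_t>0\},\qquad \alpha_t(Q\otimes D)=\infty\ \text{ on }\{D_t=0\},$$ and for $X\in\mathcal R^\infty$ let $$F_t^{Q,D}(X)=E_Q\Big[-\sum_{s\in\mathbb T_t}\frac{\gamma_s}{D_t}X_s\,\Big|\,\mathcal F_t\Big]-\alpha_t(Q\otimes D),$$ where the conditional expectation matters only on $\{D_t>0\}$ and $F_t^{Q,D}(X)=-\infty$ on $\{D_t=0\}$. Then, with the convention $0\cdot\infty=0$, for every $X\in\mathcal R^\infty$ and every $c>0$, $$Q\Big(\sup_{t\in\mathbb T\cap\mathbb N_0}\big\{D_t\big(\rho_t(X)-F_t^{Q,D}(X)\big)\big\}\ge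 c\Big)\le\frac{\rho_0(X)-F_0^{Q,D}(X)}{c},$$ where the right-hand side is a constant ($Q$-a.s.), equal to $+\infty$ if $\alpha_0(Q\otimes D)=\infty$. -/

import Mathlib

open MeasureTheory Filter Topology
open scoped ENNReal

noncomputable section

namespace RiskProc

/-! ### Time sets and processes -/

/-- The three kinds of time sets: `{0, …, T}`, `ℕ₀`, and `ℕ₀ ∪ {∞}`. -/
inductive Horizon where
  | finite (T : ℕ)
  | nat
  | natTop

/-- The set `𝕋` of time points, as a subset of `ℕ₀ ∪ {∞}`. -/
def Horizon.times : Horizon → Set ℕ∞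
  | .finite T => {t | t ≤ (T : ℕ∞)}
  | .nat => {t | t < ⊤}
  | .natTop => Set.univ

variable {Ω : Type*} {m : MeasurableSpace Ω}

/-- The σ-field `ℱ_t` for `t ∈ ℕ₀ ∪ {∞}`, where `ℱ_∞ = σ(⋃ ℱ_n)`. -/
@[reducible] def sigmaAt (ℱ : Filtration ℕ m) (t : ℕ∞) : MeasurableSpace Ω :=
  ⨆ (n : ℕ) (_ : (n : ℕ∞) ≤ t), ℱ n

theorem sigmaAt_coe (ℱ : Filtration ℕ m) (n : ℕ) : sigmaAt ℱ n = ℱ n := by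
  apply le_antisymm
  · exact iSup₂_le fun k hk => ℱ.mono (by exact_mod_cast hk)
  · exact le_iSup₂_of_le n le_rfl le_rfl

theorem sigmaAt_top (ℱ : Filtration ℕ m) : sigmaAt ℱ ⊤ = ⨆ n, ℱ n := by
  simp [sigmaAt]

theorem sigmaAt_le (ℱ : Filtration ℕ m) (t : ℕ∞) : sigmaAt ℱ t ≤ m :=
  iSup₂_le fun k _ => ℱ.le k

/-- The space `R^∞` of adapted processes `(X_t)_{t ∈ 𝕋}` that are essentially bounded uniformly in
time. Processes are given by representatives; values at times outside `𝕋` are never used. -/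
def Rinf (P : Measure Ω) (H : Horizon) (ℱ : Filtration ℕ m) : Set (ℕ∞ → Ω → ℝ) :=
  {X | (∀ t ∈ H.times, Measurable[sigmaAt ℱ t] (X t)) ∧
    ∃ C : ℝ, ∀ᵐ ω ∂P, ∀ t ∈ H.times, |X t ω| ≤ C}

/-- The projection `π_{t,T}`: `(π_{t,T} X)_r = 1_{t ≤ r} X_r`. -/
def proj (t : ℕ) (X : ℕ∞ → Ω → ℝ) : ℕ∞ → Ω → ℝ :=
  fun r ω => Set.indicator {r : ℕ∞ | (t : ℕ∞) ≤ r} (fun r => X r ω) r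

/-- The space `R_t^∞ = π_{t,T}(R^∞)`. -/
def RinfFrom (P : Measure Ω) (H : Horizon) (ℱ : Filtration ℕ m) (t : ℕ) : Set (ℕ∞ → Ω → ℝ) :=
  proj t '' Rinf P H ℱ

/-- Membership in `L^∞_t = L^∞(Ω, ℱ_t, P)` (for representatives). -/
def IsLinf (P : Measure Ω) (ℱ : Filtration ℕ m) (t : ℕ) (f : Ω → ℝ) : Prop :=
  Measurable[ℱ t] f ∧ ∃ C : ℝ, ∀ᵐ ω ∂P, |f ω| ≤ C

/-! ### Risk measures -/

/-- Conditional convex risk measures for processes at time `t`. The map is given on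
representatives; monotonicity makes it well defined on `P`-almost sure equivalence classes. -/
structure IsConditionalConvexRiskMeasure (P : Measure Ω) (H : Horizon) (ℱ : Filtration ℕ m)
    (t : ℕ) (ρ : (ℕ∞ → Ω → ℝ) → Ω → ℝ) : Prop where
  mem_Linf : ∀ X ∈ RinfFrom P H ℱ t, IsLinf P ℱ t (ρ X)
  cash_invariance : ∀ X ∈ RinfFrom P H ℱ t, ∀ k : Ω → ℝ, IsLinf P ℱ t k →
    ρ (X + proj t (fun _ => k)) =ᵐ[P] ρ X - k
  monotone : ∀ X ∈ RinfFrom P H ℱ t, ∀ Y ∈ RinfFrom P H ℱ t,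
    (∀ᵐ ω ∂P, ∀ s ∈ H.times, X s ω ≤ Y s ω) → ρ Y ≤ᵐ[P] ρ X
  convex : ∀ X ∈ RinfFrom P H ℱ t, ∀ Y ∈ RinfFrom P H ℱ t, ∀ l : Ω → ℝ, IsLinf P ℱ t l →
    (∀ᵐ ω ∂P, 0 ≤ l ω ∧ l ω ≤ 1) →
    ρ (fun s ω => l ω * X s ω + (1 - l ω) * Y s ω) ≤ᵐ[P]
      fun ω => l ω * ρ X ω + (1 - l ω) * ρ Y ω
  normalized : ρ 0 =ᵐ[P] 0

/-- Dynamic convex risk measures `(ρ_t)_{t ∈ 𝕋 ∩ ℕ₀}` for processes. -/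
def IsDynamicConvexRiskMeasure (P : Measure Ω) (H : Horizon) (ℱ : Filtration ℕ m)
    (ρ : ℕ → (ℕ∞ → Ω → ℝ) → Ω → ℝ) : Prop :=
  ∀ t : ℕ, (t : ℕ∞) ∈ H.times → IsConditionalConvexRiskMeasure P H ℱ t (ρ t)

/-- `ρ_t(X) := ρ_t(π_{t,T} X)` for `X ∈ R^∞`. -/
def evalAt (ρ : ℕ → (ℕ∞ → Ω → ℝ) → Ω → ℝ) (t : ℕ) (X : ℕ∞ → Ω → ℝ) : Ω → ℝ :=
  ρ t (proj t X)

/-- Strong time consistency. -/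
def IsTimeConsistent (P : Measure Ω) (H : Horizon) (ℱ : Filtration ℕ m)
    (ρ : ℕ → (ℕ∞ → Ω → ℝ) → Ω → ℝ) : Prop :=
  ∀ t : ℕ, ((t + 1 : ℕ) : ℕ∞) ∈ H.times → ∀ X ∈ Rinf P H ℱ, ∀ Y ∈ Rinf P H ℱ,
    X t =ᵐ[P] Y t → evalAt ρ (t + 1) X ≤ᵐ[P] evalAt ρ (t + 1) Y →
    evalAt ρ t X ≤ᵐ[P] evalAt ρ t Y

/-- Continuity from above of every `ρ_t`. -/
def IsContinuousFromAbove (P : Measure Ω) (H : Horizon) (ℱ : Filtration ℕ m)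
    (ρ : ℕ → (ℕ∞ → Ω → ℝ) → Ω → ℝ) : Prop :=
  ∀ t : ℕ, (t : ℕ∞) ∈ H.times → ∀ X : ℕ → ℕ∞ → Ω → ℝ, ∀ Y : ℕ∞ → Ω → ℝ,
    (∀ n, X n ∈ Rinf P H ℱ) → Y ∈ Rinf P H ℱ →
    (∀ᵐ ω ∂P, ∀ s ∈ H.times, Antitone fun n => X n s ω) →
    (∀ᵐ ω ∂P, ∀ s ∈ H.times, (t : ℕ∞) ≤ s → Tendsto (fun n => X n s ω) atTop (𝓝 (Y s ω))) →
    ∀ᵐ ω ∂P, Monotone (fun n => evalAt ρ t (X n) ω) ∧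
      Tendsto (fun n => evalAt ρ t (X n) ω) atTop (𝓝 (evalAt ρ t Y ω))

/-- The acceptance set `𝒜_t = {X ∈ R_t^∞ | ρ_t(X) ≤ 0}`. -/
def acceptanceSet (P : Measure Ω) (H : Horizon) (ℱ : Filtration ℕ m)
    (ρ : ℕ → (ℕ∞ → Ω → ℝ) → Ω → ℝ) (t : ℕ) : Set (ℕ∞ → Ω → ℝ) :=
  {X | X ∈ RinfFrom P H ℱ t ∧ ρ t X ≤ᵐ[P] 0}

/-! ### Models and discounting -/

/-- `Q ∈ ℳ_loc(P)`: `Q ≪ P` on `ℱ_t` for each `t ∈ 𝕋 ∩ ℕ₀`. -/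
def LocallyAbsCont (P : Measure Ω) (H : Horizon) (ℱ : Filtration ℕ m) (Q : Measure Ω) : Prop :=
  ∀ t : ℕ, (t : ℕ∞) ∈ H.times → Q.trim (ℱ.le t) ≪ P.trim (ℱ.le t)

/-- The density process `M_t = dQ/dP` on `ℱ_t`, with values in `[0, ∞]`. -/
def densityProcess (P : Measure Ω) (ℱ : Filtration ℕ m) (Q : Measure Ω) (t : ℕ) : Ω → ℝ≥0∞ :=
  (Q.trim (ℱ.le t)).rnDeriv (P.trim (ℱ.le t))

/-- The set `𝒟(Q)` of predictable discounting processes `D`. -/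
structure IsDiscounting (P : Measure Ω) (H : Horizon) (ℱ : Filtration ℕ m) (Q : Measure Ω)
    (D : ℕ∞ → Ω → ℝ) : Prop where
  measurable_zero : Measurable[ℱ 0] (D 0)
  predictable : ∀ t : ℕ, ((t + 1 : ℕ) : ℕ∞) ∈ H.times →
    Measurable[ℱ t] (D ((t + 1 : ℕ) : ℕ∞))
  measurable_top : (⊤ : ℕ∞) ∈ H.times → Measurable[sigmaAt ℱ ⊤] (D ⊤)
  zero_eq_one : ∀ᵐ ω ∂Q, D 0 ω = 1
  nonneg : ∀ᵐ ω ∂Q, ∀ t ∈ H.times, 0 ≤ D t ω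
  antitone : ∀ᵐ ω ∂Q, ∀ s ∈ H.times, ∀ t ∈ H.times, s ≤ t → D t ω ≤ D s ω
  limit :
    match H with
    | .finite _ => True
    | .nat => ∀ᵐ ω ∂Q, Tendsto (fun n : ℕ => D n ω) atTop (𝓝 0)
    | .natTop =>
      (∀ᵐ ω ∂Q, Tendsto (fun n : ℕ => D n ω) atTop (𝓝 (D ⊤ ω))) ∧
      ∀ᵐ ω ∂Q, Tendsto (fun n : ℕ => densityProcess P ℱ Q n ω) atTop (𝓝 ⊤) → D ⊤ ω = 0

open Classical in
/-- The optional random measure `γ` of `D`: `γ_t = D_t - D_{t+1}` for finite `t ∈ 𝕋` (with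
`D_{T+1} = 0` for a finite horizon `T`), and `γ_∞ = D_∞`. -/
def weights (H : Horizon) (D : ℕ∞ → Ω → ℝ) (t : ℕ∞) (ω : Ω) : ℝ :=
  if t = ⊤ then D ⊤ ω else D t ω - if t + 1 ∈ H.times then D (t + 1) ω else 0

/-- The optional σ-field on `Ω × 𝕋`. -/
@[reducible] def optionalSigma (H : Horizon) (ℱ : Filtration ℕ m) : MeasurableSpace (Ω × H.times) :=
  MeasurableSpace.generateFrom
    {B | ∃ (t : H.times) (A : Set Ω), MeasurableSet[sigmaAt ℱ t] A ∧ B = A ×ˢ {t}}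

theorem measurable_section (H : Horizon) (ℱ : Filtration ℕ m) (t : H.times) :
    @Measurable Ω (Ω × H.times) m (optionalSigma H ℱ) (fun ω => (ω, t)) := by
  refine @measurable_generateFrom Ω (Ω × H.times) m _ _ ?_
  rintro _ ⟨s, A, hA, rfl⟩
  by_cases h : t = s
  · have : (fun ω : Ω => (ω, t)) ⁻¹' (A ×ˢ {s}) = A := by ext; simp [h]
    rw [this]; exact sigmaAt_le ℱ s A hA
  · have : (fun ω : Ω => (ω, t)) ⁻¹' (A ×ˢ {s}) = ∅ := by ext; simp [h]
    rw [this]; exact MeasurableSet.empty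

/-- The measure `R ⊗ γ` on the optional σ-field, `E_{R ⊗ γ}[X] = E_R[∑_{t ∈ 𝕋} γ_t X_t]`. -/
def otimes (H : Horizon) (ℱ : Filtration ℕ m) (R : Measure Ω) (γ : ℕ∞ → Ω → ℝ) :
    @Measure (Ω × H.times) (optionalSigma H ℱ) :=
  @Measure.sum (Ω × H.times) H.times (optionalSigma H ℱ) fun t =>
    @Measure.map Ω (Ω × H.times) m (optionalSigma H ℱ) (fun ω => (ω, t))
      (R.withDensity fun ω => ENNReal.ofReal (γ t ω))

/-- Adapted reference processes `μ` with `μ_t > 0` and `∑_{t ∈ 𝕋} μ_t = 1`. -/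
structure IsReference (P : Measure Ω) (H : Horizon) (ℱ : Filtration ℕ m)
    (μ : ℕ∞ → Ω → ℝ) : Prop where
  adapted : ∀ t ∈ H.times, Measurable[sigmaAt ℱ t] (μ t)
  pos : ∀ᵐ ω ∂P, ∀ t ∈ H.times, 0 < μ t ω
  hasSum_one : ∀ᵐ ω ∂P, HasSum (fun t : H.times => μ t ω) 1

/-- `ℳ(P̄)`: the probability measures on the optional σ-field that are absolutely continuous with
respect to `P̄ = P ⊗ μ`. -/
def absContModels (P : Measure Ω) (H : Horizon) (ℱ : Filtration ℕ m) (μ : ℕ∞ → Ω → ℝ) :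
    Set (@Measure (Ω × H.times) (optionalSigma H ℱ)) :=
  {R | @IsProbabilityMeasure _ (optionalSigma H ℱ) R ∧ R ≪ otimes H ℱ P μ}

/-! ### Essential suprema of families -/

/-- `g` is a version of the `Q`-essential supremum of the family `S` of `𝒢`-measurable random
variables. -/
def IsFamilyEssSup (Q : Measure Ω) (𝒢 : MeasurableSpace Ω) (S : Set (Ω → EReal))
    (g : Ω → EReal) : Prop :=
  Measurable[𝒢] g ∧ (∀ f ∈ S, f ≤ᵐ[Q] g) ∧
    ∀ h : Ω → EReal, Measurable[𝒢] h → (∀ f ∈ S, f ≤ᵐ[Q] h) → g ≤ᵐ[Q] h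

/-- A version of the `Q`-essential supremum of the family `S`. -/
def familyEssSup (Q : Measure Ω) (𝒢 : MeasurableSpace Ω) (S : Set (Ω → EReal)) : Ω → EReal :=
  Classical.epsilon (IsFamilyEssSup Q 𝒢 S)

theorem exists_isFamilyEssSup (Q : Measure Ω) [IsFiniteMeasure Q] (𝒢 : MeasurableSpace Ω)
    (h𝒢 : 𝒢 ≤ m) (S : Set (Ω → EReal)) (hS : ∀ f ∈ S, Measurable[𝒢] f) :
    ∃ g, IsFamilyEssSup Q 𝒢 S g := by
  classical
  -- for each level `q`, exhaust the union of the sets `{q < f}` by a countable subfamily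
  have key : ∀ q : ℚ, ∃ C : Set (Ω → EReal), C.Countable ∧ C ⊆ S ∧
      ∀ f ∈ S, ∀ᵐ ω ∂Q, ((q : ℝ) : EReal) < f ω → ∃ k ∈ C, ((q : ℝ) : EReal) < k ω := by
    intro q
    let U : Set (Ω → EReal) → Set Ω := fun C => {ω | ∃ k ∈ C, ((q : ℝ) : EReal) < k ω}
    have hU : ∀ C : Set (Ω → EReal), C.Countable → C ⊆ S →
        MeasurableSet[m] (U C) := by
      intro C hC hCS
      have : U C = ⋃ k ∈ C, {ω | ((q : ℝ) : EReal) < k ω} := by ext; simp [U]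
      rw [this]
      exact MeasurableSet.biUnion hC fun k hk =>
        h𝒢 _ (measurableSet_lt measurable_const (hS k (hCS hk)))
    let V : Set ℝ≥0∞ := {x | ∃ C : Set (Ω → EReal), C.Countable ∧ C ⊆ S ∧ x = Q (U C)}
    have hV : V.Nonempty := ⟨_, ∅, Set.countable_empty, Set.empty_subset _, rfl⟩
    obtain ⟨u, -, hu, huV⟩ := exists_seq_tendsto_sSup hV (OrderTop.bddAbove V)
    choose C hC hCS huC using huV
    have hc : (⋃ n, C n).Countable := Set.countable_iUnion hC
    have hs : (⋃ n, C n) ⊆ S := Set.iUnion_subset hCS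
    refine ⟨⋃ n, C n, hc, hs, fun f hf => ?_⟩
    have hge : sSup V ≤ Q (U (⋃ n, C n)) := by
      refine le_of_tendsto' hu fun n => ?_
      rw [huC n]
      refine measure_mono ?_
      rintro ω ⟨k, hk, hkω⟩
      exact ⟨k, Set.mem_iUnion.2 ⟨n, hk⟩, hkω⟩
    have hle : Q (U (insert f (⋃ n, C n))) ≤ sSup V :=
      le_sSup ⟨_, hc.insert f, Set.insert_subset hf hs, rfl⟩
    have hsub : U (⋃ n, C n) ⊆ U (insert f (⋃ n, C n)) := by
      rintro ω ⟨k, hk, hkω⟩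
      exact ⟨k, Set.mem_insert_of_mem _ hk, hkω⟩
    have hnull : Q (U (insert f (⋃ n, C n)) \ U (⋃ n, C n)) = 0 := by
      rw [measure_sdiff hsub (hU _ hc hs).nullMeasurableSet (measure_ne_top _ _)]
      exact tsub_eq_zero_of_le (hle.trans hge)
    rw [ae_iff]
    refine measure_mono_null ?_ hnull
    intro ω hω
    simp only [Set.mem_ofPred_eq, Classical.not_imp] at hω
    exact ⟨⟨f, Set.mem_insert _ _, hω.1⟩, hω.2⟩
  choose C hC hCS hCf using key
  have hc : (⋃ q, C q).Countable := Set.countable_iUnion hC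
  refine ⟨fun ω => ⨆ k ∈ ⋃ q, C q, k ω, ?_, ?_, ?_⟩
  · refine Measurable.biSup _ hc fun k hk => ?_
    obtain ⟨q, hq⟩ := Set.mem_iUnion.1 hk
    exact hS k (hCS q hq)
  · intro f hf
    have : ∀ᵐ ω ∂Q, ∀ q : ℚ, ((q : ℝ) : EReal) < f ω →
        ∃ k ∈ C q, ((q : ℝ) : EReal) < k ω := ae_all_iff.2 fun q => hCf q f hf
    filter_upwards [this] with ω hω
    refine le_of_forall_lt fun c hcf => ?_
    obtain ⟨q, hq1, hq2⟩ := EReal.lt_iff_exists_rat_btwn.1 hcf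
    obtain ⟨k, hk, hkq⟩ := hω q hq2
    exact (hq1.trans hkq).trans_le
      (le_iSup₂ (f := fun (k : Ω → EReal) (_ : k ∈ ⋃ q, C q) => k ω) k
        (Set.mem_iUnion.2 ⟨q, hk⟩))
  · intro h _ hh
    have : ∀ᵐ ω ∂Q, ∀ k ∈ ⋃ q, C q, k ω ≤ h ω := (ae_ball_iff hc).2 fun k hk => by
      obtain ⟨q, hq⟩ := Set.mem_iUnion.1 hk
      exact hh k (hCS q hq)
    filter_upwards [this] with ω hω
    exact iSup₂_le hω

theorem isFamilyEssSup_familyEssSup (Q : Measure Ω) [IsFiniteMeasure Q] (𝒢 : MeasurableSpace Ω)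
    (h𝒢 : 𝒢 ≤ m) (S : Set (Ω → EReal)) (hS : ∀ f ∈ S, Measurable[𝒢] f) :
    IsFamilyEssSup Q 𝒢 S (familyEssSup Q 𝒢 S) :=
  Classical.epsilon_spec (exists_isFamilyEssSup Q 𝒢 h𝒢 S hS)

/-! ### Penalty and penalized expected loss -/

/-- The conditional expected loss `E_Q[-∑_{s ∈ 𝕋, s ≥ t} (γ_s / D_t) X_s | ℱ_t]`, relevant on
`{D_t > 0}`. -/
def expectedLoss (H : Horizon) (ℱ : Filtration ℕ m) (Q : Measure Ω) (D : ℕ∞ → Ω → ℝ) (t : ℕ)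
    (X : ℕ∞ → Ω → ℝ) : Ω → ℝ :=
  Q[fun ω => -∑' s : {s : ℕ∞ // s ∈ H.times ∧ (t : ℕ∞) ≤ s},
      weights H D s ω / D t ω * X s ω | ℱ t]

open Classical in
/-- The minimal penalty `α_t(Q ⊗ D)`: the `Q`-essential supremum of the conditional expected losses
over the acceptance set on `{D_t > 0}`, and `∞` on `{D_t = 0}`. -/
def penalty (P : Measure Ω) (H : Horizon) (ℱ : Filtration ℕ m)
    (ρ : ℕ → (ℕ∞ → Ω → ℝ) → Ω → ℝ) (Q : Measure Ω) (D : ℕ∞ → Ω → ℝ) (t : ℕ) (ω : Ω) : EReal :=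
  if 0 < D t ω then
    familyEssSup Q (ℱ t)
      {f | ∃ X ∈ acceptanceSet P H ℱ ρ t, f = fun ω => (expectedLoss H ℱ Q D t X ω : EReal)} ω
  else ⊤

/-- The penalized expected loss
`F_t^{Q,D}(X) = E_Q[-∑_{s ∈ 𝕋, s ≥ t} (γ_s / D_t) X_s | ℱ_t] - α_t(Q ⊗ D)`. -/
def riskEvaluation (P : Measure Ω) (H : Horizon) (ℱ : Filtration ℕ m)
    (ρ : ℕ → (ℕ∞ → Ω → ℝ) → Ω → ℝ) (Q : Measure Ω) (D : ℕ∞ → Ω → ℝ) (t : ℕ)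
    (X : ℕ∞ → Ω → ℝ) (ω : Ω) : EReal :=
  (expectedLoss H ℱ Q D t X ω : EReal) - penalty P H ℱ ρ Q D t ω

end RiskProc

end

namespace RiskProc

variable {Ω : Type*} {m : MeasurableSpace Ω}

/-! ### A maximal inequality for nonnegative supermartingales -/

theorem mul_measure_exists_ge_le (Q : Measure Ω) (ℱ : Filtration ℕ m) {W : ℕ → Ω → ℝ≥0∞}
    (hW : ∀ k, Measurable[ℱ k] (W k))
    (hsuper : ∀ k A, MeasurableSet[ℱ k] A → ∫⁻ ω in A, W (k + 1) ω ∂Q ≤ ∫⁻ ω in A, W k ω ∂Q)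
    (c : ℝ≥0∞) (N : ℕ) : ∀ (k : ℕ) (A : Set Ω), MeasurableSet[ℱ k] A →
      c * Q (A ∩ {ω | ∃ j ≤ N, c ≤ W (k + j) ω}) ≤ ∫⁻ ω in A, W k ω ∂Q := by
  have markov : ∀ (k : ℕ) (A : Set Ω), MeasurableSet[ℱ k] A →
      c * Q (A ∩ {ω | c ≤ W k ω}) ≤ ∫⁻ ω in A ∩ {ω | c ≤ W k ω}, W k ω ∂Q := by
    intro k A hA
    have hB : MeasurableSet[ℱ k] (A ∩ {ω | c ≤ W k ω}) :=
      hA.inter (measurableSet_le measurable_const (hW k))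
    rw [← setLIntegral_const]
    exact setLIntegral_mono' (ℱ.le k _ hB) fun ω hω => hω.2
  induction N with
  | zero =>
    intro k A hA
    simp only [Nat.le_zero, exists_eq_left, add_zero]
    exact (markov k A hA).trans (lintegral_mono_set Set.inter_subset_left)
  | succ N ih =>
    intro k A hA
    have hB : MeasurableSet[ℱ k] {ω | c ≤ W k ω} := measurableSet_le measurable_const (hW k)
    have hC : MeasurableSet[ℱ k] (A \ {ω | c ≤ W k ω}) := hA.diff hB
    have hsub : A ∩ {ω | ∃ j ≤ N + 1, c ≤ W (k + j) ω} ⊆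
        (A ∩ {ω | c ≤ W k ω}) ∪
          ((A \ {ω | c ≤ W k ω}) ∩ {ω | ∃ j ≤ N, c ≤ W (k + 1 + j) ω}) := by
      rintro ω ⟨hωA, j, hj, hjc⟩
      by_cases h : c ≤ W k ω
      · exact Or.inl ⟨hωA, h⟩
      · refine Or.inr ⟨⟨hωA, h⟩, ?_⟩
        cases j with
        | zero => exact absurd hjc h
        | succ j => exact ⟨j, by omega, by rwa [add_assoc, add_comm 1 j]⟩
    calc c * Q (A ∩ {ω | ∃ j ≤ N + 1, c ≤ W (k + j) ω})
        ≤ c * (Q (A ∩ {ω | c ≤ W k ω}) +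
          Q ((A \ {ω | c ≤ W k ω}) ∩ {ω | ∃ j ≤ N, c ≤ W (k + 1 + j) ω})) := by
          gcongr
          exact (measure_mono hsub).trans (measure_union_le _ _)
      _ ≤ ∫⁻ ω in A ∩ {ω | c ≤ W k ω}, W k ω ∂Q + ∫⁻ ω in A \ {ω | c ≤ W k ω}, W k ω ∂Q := by
          rw [mul_add]
          exact add_le_add (markov k A hA)
            ((ih (k + 1) _ (ℱ.mono k.le_succ _ hC)).trans (hsuper k _ hC))
      _ = ∫⁻ ω in A, W k ω ∂Q := lintegral_inter_add_sdiff _ _ (ℱ.le k _ hB)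

theorem mul_measure_iSup_ge_le (Q : Measure Ω) (ℱ : Filtration ℕ m) {W : ℕ → Ω → ℝ≥0∞}
    (hW : ∀ k, Measurable[ℱ k] (W k))
    (hsuper : ∀ k A, MeasurableSet[ℱ k] A → ∫⁻ ω in A, W (k + 1) ω ∂Q ≤ ∫⁻ ω in A, W k ω ∂Q)
    (c : ℝ≥0∞) : c * Q {ω | c ≤ ⨆ k, W k ω} ≤ ∫⁻ ω, W 0 ω ∂Q := by
  refine ENNReal.mul_le_of_forall_lt fun a ha b hb => ?_
  have hsub : {ω | c ≤ ⨆ k, W k ω} ⊆ ⋃ N : ℕ, {ω | ∃ j ≤ N, a ≤ W (0 + j) ω} := by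
    intro ω hω
    obtain ⟨k, hk⟩ := lt_iSup_iff.1 (ha.trans_le hω)
    exact Set.mem_iUnion.2 ⟨k, k, le_rfl, by simpa using hk.le⟩
  have hmono : Monotone fun N : ℕ => {ω | ∃ j ≤ N, a ≤ W (0 + j) ω} := by
    rintro N M hNM ω ⟨j, hj, h⟩
    exact ⟨j, hj.trans hNM, h⟩
  have hb' := hb.trans_le (measure_mono hsub)
  rw [hmono.measure_iUnion] at hb'
  obtain ⟨N, hN⟩ := lt_iSup_iff.1 hb'
  have := mul_measure_exists_ge_le Q ℱ hW hsuper a N 0 Set.univ MeasurableSet.univ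
  rw [Set.univ_inter, setLIntegral_univ] at this
  exact (mul_le_mul_right hN.le a).trans this

/-! ### Essential suprema are attained along countable subfamilies -/

theorem exists_countable_ae_le_iSup (Q : Measure Ω) [IsFiniteMeasure Q]
    (S : Set (Ω → EReal)) (hS : ∀ f ∈ S, Measurable f) :
    ∃ C : Set (Ω → EReal), C.Countable ∧ C ⊆ S ∧ ∀ f ∈ S, ∀ᵐ ω ∂Q, f ω ≤ ⨆ k ∈ C, k ω := by
  have key : ∀ q : ℚ, ∃ C : Set (Ω → EReal), C.Countable ∧ C ⊆ S ∧
      ∀ f ∈ S, ∀ᵐ ω ∂Q, ((q : ℝ) : EReal) < f ω → ∃ k ∈ C, ((q : ℝ) : EReal) < k ω := by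
    intro q
    let U : Set (Ω → EReal) → Set Ω := fun C => {ω | ∃ k ∈ C, ((q : ℝ) : EReal) < k ω}
    have hU : ∀ C : Set (Ω → EReal), C.Countable → C ⊆ S → MeasurableSet (U C) := by
      intro C hC hCS
      have : U C = ⋃ k ∈ C, {ω | ((q : ℝ) : EReal) < k ω} := by ext; simp [U]
      rw [this]
      exact MeasurableSet.biUnion hC fun k hk => measurableSet_lt measurable_const (hS k (hCS hk))
    let V : Set ℝ≥0∞ := {x | ∃ C : Set (Ω → EReal), C.Countable ∧ C ⊆ S ∧ x = Q (U C)}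
    have hV : V.Nonempty := ⟨_, ∅, Set.countable_empty, Set.empty_subset _, rfl⟩
    obtain ⟨u, -, hu, huV⟩ := exists_seq_tendsto_sSup hV (OrderTop.bddAbove V)
    choose C hC hCS huC using huV
    have hc : (⋃ n, C n).Countable := Set.countable_iUnion hC
    have hs : (⋃ n, C n) ⊆ S := Set.iUnion_subset hCS
    refine ⟨⋃ n, C n, hc, hs, fun f hf => ?_⟩
    have hge : sSup V ≤ Q (U (⋃ n, C n)) := by
      refine le_of_tendsto' hu fun n => ?_
      rw [huC n]
      refine measure_mono ?_
      rintro ω ⟨k, hk, hkω⟩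
      exact ⟨k, Set.mem_iUnion.2 ⟨n, hk⟩, hkω⟩
    have hle : Q (U (insert f (⋃ n, C n))) ≤ sSup V :=
      le_sSup ⟨_, hc.insert f, Set.insert_subset hf hs, rfl⟩
    have hsub : U (⋃ n, C n) ⊆ U (insert f (⋃ n, C n)) := by
      rintro ω ⟨k, hk, hkω⟩
      exact ⟨k, Set.mem_insert_of_mem _ hk, hkω⟩
    have hnull : Q (U (insert f (⋃ n, C n)) \ U (⋃ n, C n)) = 0 := by
      rw [measure_sdiff hsub (hU _ hc hs).nullMeasurableSet (measure_ne_top _ _)]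
      exact tsub_eq_zero_of_le (hle.trans hge)
    filter_upwards [measure_eq_zero_iff_ae_notMem.1 hnull] with ω hω hfω
    by_contra hk
    exact hω ⟨⟨f, Set.mem_insert _ _, hfω⟩, hk⟩
  choose C hC hCS hCf using key
  refine ⟨⋃ q, C q, Set.countable_iUnion hC, Set.iUnion_subset hCS, fun f hf => ?_⟩
  filter_upwards [ae_all_iff.2 fun q => hCf q f hf] with ω hω
  refine le_of_forall_lt fun c hcf => ?_
  obtain ⟨q, hq1, hq2⟩ := EReal.lt_iff_exists_rat_btwn.1 hcf
  obtain ⟨k, hk, hkq⟩ := hω q hq2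
  exact (hq1.trans hkq).trans_le
    (le_iSup₂ (f := fun (k : Ω → EReal) (_ : k ∈ ⋃ q, C q) => k ω) k (Set.mem_iUnion.2 ⟨q, hk⟩))

/-! ### Discounting weights -/

/-- The times `s ∈ 𝕋` with `s ≥ t`. -/
def timesFrom (H : Horizon) (t : ℕ) : Set ℕ∞ := {s | s ∈ H.times ∧ (t : ℕ∞) ≤ s}

theorem mem_times_of_le {H : Horizon} {s t : ℕ} (hst : s ≤ t) (ht : (t : ℕ∞) ∈ H.times) :
    (s : ℕ∞) ∈ H.times := by
  have hst' : (s : ℕ∞) ≤ t := by exact_mod_cast hst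
  cases H with
  | finite T => exact hst'.trans ht
  | nat => exact ENat.natCast_lt_top s
  | natTop => trivial

theorem hasSum_indicator_weights_of_tendsto {H : Horizon} {D : ℕ∞ → Ω → ℝ} {ω : Ω}
    (hnonneg : ∀ t ∈ H.times, 0 ≤ D t ω)
    (hanti : ∀ s ∈ H.times, ∀ t ∈ H.times, s ≤ t → D t ω ≤ D s ω)
    (hlim : Tendsto (fun n : ℕ => H.times.indicator (fun s => D s ω) n) atTop
      (𝓝 (H.times.indicator (fun s => D s ω) ⊤)))
    (t : ℕ) (ht : (t : ℕ∞) ∈ H.times) :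
    HasSum ((timesFrom H t).indicator fun s => weights H D s ω) (D t ω) := by
  classical
  set d : ℕ∞ → ℝ := H.times.indicator fun s => D s ω with hd
  have hanti' : Antitone fun n : ℕ => d n := by
    refine antitone_nat_of_succ_le fun n => ?_
    by_cases h : ((n + 1 : ℕ) : ℕ∞) ∈ H.times
    · have h' := mem_times_of_le n.le_succ h
      simp only [hd, Set.indicator_of_mem h, Set.indicator_of_mem h']
      exact hanti _ h' _ h (by exact_mod_cast n.le_succ)
    · simp only [hd, Set.indicator_of_notMem h]
      exact Set.indicator_nonneg (fun s hs => hnonneg s hs) _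
  set e : ℕ → ℝ := fun n => d (max t n : ℕ) with he
  have hsum : HasSum (fun n => e n - e (n + 1)) (d t - d ⊤) := by
    rw [hasSum_iff_tendsto_nat_of_nonneg]
    · simp only [Finset.sum_range_sub']
      have h0 : e 0 = d t := by simp [he]
      rw [h0]
      refine tendsto_const_nhds.sub (hlim.congr' ?_)
      filter_upwards [eventually_ge_atTop t] with n hn
      simp [he, max_eq_right hn]
    · intro n
      exact sub_nonneg.2 (hanti' (max_le_max le_rfl n.le_succ))
  have hdt : d t = D t ω := Set.indicator_of_mem ht _
  set f1 : ℕ∞ → ℝ := fun s => if s = ⊤ then 0 else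
    (timesFrom H t).indicator (fun s => weights H D s ω) s with hf1
  have h1 : HasSum f1 (d t - d ⊤) := by
    rw [← (Nat.cast_injective (R := ℕ∞)).hasSum_iff]
    · convert! hsum using 2 with n
      simp only [Function.comp, hf1, ENat.natCast_ne_top, if_false]
      by_cases hn : t ≤ n
      · have hn' : (t : ℕ∞) ≤ n := by exact_mod_cast hn
        have e1 : e n = d n := by simp [he, max_eq_right hn]
        have e2 : e (n + 1) = d (n + 1 : ℕ) := by simp only [he]; rw [max_eq_right (by omega)]
        rw [e1, e2]
        by_cases h : (n : ℕ∞) ∈ H.times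
        · rw [Set.indicator_of_mem (show (n : ℕ∞) ∈ timesFrom H t from ⟨h, hn'⟩)]
          simp only [hd, Set.indicator, h, weights, ENat.natCast_ne_top, if_false, if_true]
          push_cast
          rfl
        · have h2 : ((n + 1 : ℕ) : ℕ∞) ∉ H.times := fun h' => h (mem_times_of_le n.le_succ h')
          rw [Set.indicator_of_notMem (fun h' => h h'.1)]
          simp only [hd, Set.indicator, h, h2, if_false, sub_zero]
      · have hn' : ¬ (t : ℕ∞) ≤ n := by exact_mod_cast hn
        rw [Set.indicator_of_notMem (fun h' => hn' h'.2)]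
        simp only [he]
        rw [max_eq_left (by omega), max_eq_left (by omega), sub_self]
    · intro s hs
      have : s = ⊤ := by
        by_contra h
        obtain ⟨n, rfl⟩ := ENat.ne_top_iff_exists.1 h
        exact hs ⟨n, rfl⟩
      simp [hf1, this]
  have h2 := hasSum_ite_eq (⊤ : ℕ∞) (d ⊤)
  have h3 := h1.add h2
  rw [sub_add_cancel, hdt] at h3
  convert! h3 using 2 with s
  by_cases hs : s = ⊤
  · subst hs
    simp only [hf1, if_true, zero_add, hd]
    by_cases h : (⊤ : ℕ∞) ∈ H.times
    · rw [Set.indicator_of_mem (show (⊤ : ℕ∞) ∈ timesFrom H t from ⟨h, le_top⟩),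
        Set.indicator_of_mem h]
      simp [weights]
    · rw [Set.indicator_of_notMem (fun h' => h h'.1), Set.indicator_of_notMem h]
  · simp [hf1, hs]

theorem weights_nonneg {H : Horizon} {D : ℕ∞ → Ω → ℝ} {ω : Ω}
    (hnonneg : ∀ t ∈ H.times, 0 ≤ D t ω)
    (hanti : ∀ s ∈ H.times, ∀ t ∈ H.times, s ≤ t → D t ω ≤ D s ω) (s : ℕ∞) (hs : s ∈ H.times) :
    0 ≤ weights H D s ω := by
  unfold weights
  split_ifs with h1 h2
  · exact hnonneg _ (h1 ▸ hs)
  · exact sub_nonneg.2 (hanti _ hs _ h2 le_self_add)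
  · simpa using hnonneg _ hs

theorem IsDiscounting.tendsto_indicator {P Q : Measure Ω} {H : Horizon} {ℱ : Filtration ℕ m}
    {D : ℕ∞ → Ω → ℝ} (hD : IsDiscounting P H ℱ Q D) :
    ∀ᵐ ω ∂Q, Tendsto (fun n : ℕ => H.times.indicator (fun s => D s ω) n) atTop
      (𝓝 (H.times.indicator (fun s => D s ω) ⊤)) := by
  have hlim := hD.limit
  cases H with
  | finite T =>
    refine ae_of_all _ fun ω => ?_
    have : (⊤ : ℕ∞) ∉ (Horizon.finite T).times := by simp [Horizon.times]
    rw [Set.indicator_of_notMem this]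
    refine tendsto_const_nhds.congr' ?_
    filter_upwards [eventually_gt_atTop T] with n hn
    rw [Set.indicator_of_notMem]
    simpa [Horizon.times] using hn
  | nat =>
    filter_upwards [hlim] with ω hω
    have h1 : (⊤ : ℕ∞) ∉ Horizon.nat.times := by simp [Horizon.times]
    have h2 : ∀ n : ℕ, (n : ℕ∞) ∈ Horizon.nat.times := by simp [Horizon.times]
    rw [Set.indicator_of_notMem h1]
    simpa only [Set.indicator_of_mem (h2 _)] using hω
  | natTop =>
    filter_upwards [hlim.1] with ω hω
    simpa [Horizon.times] using hω

theorem IsDiscounting.hasSum_indicator_weights {P Q : Measure Ω} {H : Horizon}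
    {ℱ : Filtration ℕ m} {D : ℕ∞ → Ω → ℝ} (hD : IsDiscounting P H ℱ Q D) :
    ∀ᵐ ω ∂Q, (∀ s ∈ H.times, 0 ≤ weights H D s ω) ∧ ∀ t : ℕ, (t : ℕ∞) ∈ H.times →
      HasSum ((timesFrom H t).indicator fun s => weights H D s ω) (D t ω) := by
  filter_upwards [hD.nonneg, hD.antitone, hD.tendsto_indicator] with ω h1 h2 h3
  exact ⟨weights_nonneg h1 h2, hasSum_indicator_weights_of_tendsto h1 h2 h3⟩

theorem IsDiscounting.measurable {P Q : Measure Ω} {H : Horizon}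
    {ℱ : Filtration ℕ m} {D : ℕ∞ → Ω → ℝ} (hD : IsDiscounting P H ℱ Q D) (t : ℕ)
    (ht : (t : ℕ∞) ∈ H.times) : Measurable[ℱ t] (D t) := by
  cases t with
  | zero => exact_mod_cast hD.measurable_zero
  | succ t => exact (hD.predictable t ht).mono (ℱ.mono t.le_succ) le_rfl

theorem IsDiscounting.measurable_weights {P Q : Measure Ω} {H : Horizon}
    {ℱ : Filtration ℕ m} {D : ℕ∞ → Ω → ℝ} (hD : IsDiscounting P H ℱ Q D) (s : ℕ∞)
    (hs : s ∈ H.times) : Measurable (weights H D s) := by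
  have hmeas : ∀ t ∈ H.times, Measurable (D t) := by
    intro t ht
    induction t with
    | top => exact (hD.measurable_top ht).mono (sigmaAt_le ℱ ⊤) le_rfl
    | coe n => exact (hD.measurable n ht).mono (ℱ.le n) le_rfl
  unfold weights
  split_ifs with h1 h2
  · exact hmeas _ (h1 ▸ hs)
  · exact (hmeas _ hs).sub (hmeas _ h2)
  · simpa using hmeas _ hs

/-- Events that are `P`-null at time `s` carry no discounting weight at time `s` under `Q`. -/
theorem ae_weights_eq_zero_of_absolutelyContinuous {P Q : Measure Ω} {H : Horizon}
    {ℱ : Filtration ℕ m} {γ μ : ℕ∞ → Ω → ℝ} (hγ : ∀ s ∈ H.times, Measurable (γ s))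
    (hac : otimes H ℱ Q γ ≪ otimes H ℱ P μ) {s : ℕ∞} (hs : s ∈ H.times) {N : Set Ω}
    (hN : MeasurableSet[sigmaAt ℱ s] N) (hPN : P N = 0) :
    ∀ᵐ ω ∂Q, ω ∈ N → γ s ω ≤ 0 := by
  let _ := optionalSigma H ℱ
  let B : Set (Ω × H.times) := N ×ˢ {⟨s, hs⟩}
  have hB : MeasurableSet B := MeasurableSpace.measurableSet_generateFrom ⟨⟨s, hs⟩, N, hN, rfl⟩
  have hpre : ∀ t : H.times, (fun ω : Ω => (ω, t)) ⁻¹' B ⊆ N := fun t ω hω => hω.1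
  have hP : otimes H ℱ P μ B = 0 := by
    rw [otimes, Measure.sum_apply _ hB, ENNReal.tsum_eq_zero]
    intro t
    rw [Measure.map_apply (measurable_section H ℱ t) hB]
    exact withDensity_absolutelyContinuous _ _ (measure_mono_null (hpre t) hPN)
  have hQ := hac hP
  rw [otimes, Measure.sum_apply _ hB, ENNReal.tsum_eq_zero] at hQ
  have h := hQ ⟨s, hs⟩
  rw [Measure.map_apply (measurable_section H ℱ ⟨s, hs⟩) hB] at h
  have hpre' : (fun ω : Ω => (ω, (⟨s, hs⟩ : H.times))) ⁻¹' B = N := by ext; simp [B]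
  rw [hpre', withDensity_apply_eq_zero ((hγ s hs).ennreal_ofReal)] at h
  filter_upwards [measure_eq_zero_iff_ae_notMem.1 h] with ω hω hωN
  by_contra hpos
  exact hω ⟨by simpa using hpos, hωN⟩

theorem exists_ae_abs_weights_mul_le {P Q : Measure Ω} {H : Horizon}
    {ℱ : Filtration ℕ m} {γ μ X : ℕ∞ → Ω → ℝ} (hγ : ∀ s ∈ H.times, Measurable (γ s))
    (hγ0 : ∀ᵐ ω ∂Q, ∀ s ∈ H.times, 0 ≤ γ s ω)
    (hac : otimes H ℱ Q γ ≪ otimes H ℱ P μ) (hX : X ∈ Rinf P H ℱ) :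
    ∃ C : ℝ, 0 ≤ C ∧ ∀ᵐ ω ∂Q, ∀ s ∈ H.times, |γ s ω * X s ω| ≤ C * γ s ω := by
  obtain ⟨hXm, C, hC⟩ := hX
  refine ⟨max C 0, le_max_right _ _, ?_⟩
  have h : ∀ s ∈ H.times, ∀ᵐ ω ∂Q, ω ∈ {ω | C < |X s ω|} → γ s ω ≤ 0 := by
    intro s hs
    refine ae_weights_eq_zero_of_absolutelyContinuous hγ hac hs ?_ ?_
    · have := hXm s hs
      exact measurableSet_lt measurable_const (continuous_abs.measurable.comp this)
    · refine measure_eq_zero_iff_ae_notMem.2 ?_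
      filter_upwards [hC] with ω hω
      exact not_lt.2 (hω s hs)
  filter_upwards [hγ0, (ae_ball_iff H.times.to_countable).2 h] with ω h0 h1 s hs
  rw [abs_mul, abs_of_nonneg (h0 s hs)]
  by_cases hlt : C < |X s ω|
  · have : γ s ω = 0 := le_antisymm (h1 s hs hlt) (h0 s hs)
    simp [this]
  · rw [mul_comm]
    exact mul_le_mul_of_nonneg_right ((not_lt.1 hlt).trans (le_max_left _ _)) (h0 s hs)

/-! ### Bounded adapted processes -/

theorem proj_of_le {t : ℕ} {s : ℕ∞} (h : (t : ℕ∞) ≤ s) (X : ℕ∞ → Ω → ℝ) : proj t X s = X s := by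
  funext ω
  exact Set.indicator_of_mem (s := {r : ℕ∞ | (t : ℕ∞) ≤ r}) h _

theorem proj_of_not_le {t : ℕ} {s : ℕ∞} (h : ¬ (t : ℕ∞) ≤ s) (X : ℕ∞ → Ω → ℝ) :
    proj t X s = 0 := by
  funext ω
  exact Set.indicator_of_notMem (s := {r : ℕ∞ | (t : ℕ∞) ≤ r}) h _

theorem filtration_le_sigmaAt (ℱ : Filtration ℕ m) {t : ℕ} {s : ℕ∞} (h : (t : ℕ∞) ≤ s) :
    ℱ t ≤ sigmaAt ℱ s :=
  le_iSup₂_of_le t h le_rfl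

theorem mem_RinfFrom {P : Measure Ω} {H : Horizon} {ℱ : Filtration ℕ m} {t : ℕ}
    {Z : ℕ∞ → Ω → ℝ} (hzero : ∀ s, ¬ (t : ℕ∞) ≤ s → Z s = 0)
    (hmeas : ∀ s ∈ H.times, (t : ℕ∞) ≤ s → Measurable[sigmaAt ℱ s] (Z s)) {C : ℝ}
    (hbdd : ∀ᵐ ω ∂P, ∀ s ∈ H.times, (t : ℕ∞) ≤ s → |Z s ω| ≤ C) :
    Z ∈ RinfFrom P H ℱ t := by
  refine ⟨Z, ⟨fun s hs => ?_, max C 0, ?_⟩, ?_⟩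
  · by_cases h : (t : ℕ∞) ≤ s
    · exact hmeas s hs h
    · rw [hzero s h]; exact measurable_const
  · filter_upwards [hbdd] with ω hω s hs
    by_cases h : (t : ℕ∞) ≤ s
    · exact (hω s hs h).trans (le_max_left _ _)
    · simp [hzero s h]
  · funext s
    by_cases h : (t : ℕ∞) ≤ s
    · exact proj_of_le h Z
    · rw [proj_of_not_le h, hzero s h]

theorem proj_mem_RinfFrom {P : Measure Ω} {H : Horizon} {ℱ : Filtration ℕ m} (t : ℕ)
    {X : ℕ∞ → Ω → ℝ} (hX : X ∈ Rinf P H ℱ) : proj t X ∈ RinfFrom P H ℱ t := ⟨X, hX, rfl⟩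

theorem eq_zero_of_mem_RinfFrom {P : Measure Ω} {H : Horizon} {ℱ : Filtration ℕ m} {t : ℕ}
    {Z : ℕ∞ → Ω → ℝ} (hZ : Z ∈ RinfFrom P H ℱ t) {s : ℕ∞} (hs : ¬ (t : ℕ∞) ≤ s) : Z s = 0 := by
  obtain ⟨X, -, rfl⟩ := hZ
  exact proj_of_not_le hs X

theorem RinfFrom_subset_Rinf {P : Measure Ω} {H : Horizon} {ℱ : Filtration ℕ m} (t : ℕ) :
    RinfFrom P H ℱ t ⊆ Rinf P H ℱ := by
  rintro _ ⟨X, ⟨hm, C, hC⟩, rfl⟩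
  refine ⟨fun s hs => ?_, max C 0, ?_⟩
  · by_cases h : (t : ℕ∞) ≤ s
    · rw [proj_of_le h]; exact hm s hs
    · rw [proj_of_not_le h]; exact measurable_const
  · filter_upwards [hC] with ω hω s hs
    by_cases h : (t : ℕ∞) ≤ s
    · rw [proj_of_le h]; exact (hω s hs).trans (le_max_left _ _)
    · simp [proj_of_not_le h]

theorem proj_const_mem_RinfFrom {P : Measure Ω} {H : Horizon} {ℱ : Filtration ℕ m} {t : ℕ}
    {k : Ω → ℝ} (hk : IsLinf P ℱ t k) : proj t (fun _ => k) ∈ RinfFrom P H ℱ t := by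
  obtain ⟨hm, C, hC⟩ := hk
  refine mem_RinfFrom (C := C) (fun s hs => proj_of_not_le hs _) (fun s _ h => ?_) ?_
  · rw [proj_of_le h]
    exact hm.mono (filtration_le_sigmaAt ℱ h) le_rfl
  · filter_upwards [hC] with ω hω s _ h
    rwa [proj_of_le h]

theorem Rinf_add {P : Measure Ω} {H : Horizon} {ℱ : Filtration ℕ m} {X Y : ℕ∞ → Ω → ℝ}
    (hX : X ∈ Rinf P H ℱ) (hY : Y ∈ Rinf P H ℱ) : X + Y ∈ Rinf P H ℱ := by
  obtain ⟨hXm, C, hC⟩ := hX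
  obtain ⟨hYm, K, hK⟩ := hY
  refine ⟨fun s hs => (hXm s hs).add (hYm s hs), C + K, ?_⟩
  filter_upwards [hC, hK] with ω h1 h2 s hs
  exact (abs_add_le _ _).trans (add_le_add (h1 s hs) (h2 s hs))

theorem RinfFrom_add {P : Measure Ω} {H : Horizon} {ℱ : Filtration ℕ m} {t : ℕ}
    {X Y : ℕ∞ → Ω → ℝ} (hX : X ∈ RinfFrom P H ℱ t) (hY : Y ∈ RinfFrom P H ℱ t) :
    X + Y ∈ RinfFrom P H ℱ t := by
  obtain ⟨X, hX, rfl⟩ := hX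
  obtain ⟨Y, hY, rfl⟩ := hY
  refine ⟨X + Y, Rinf_add hX hY, ?_⟩
  funext s
  by_cases h : (t : ℕ∞) ≤ s
  · simp [proj_of_le h]
  · simp [proj_of_not_le h]

theorem IsLinf.neg {P : Measure Ω} {ℱ : Filtration ℕ m} {t : ℕ} {k : Ω → ℝ}
    (hk : IsLinf P ℱ t k) : IsLinf P ℱ t (-k) :=
  ⟨hk.1.neg, by simpa using hk.2⟩

theorem IsLinf.of_locallyAbsCont {P Q : Measure Ω} {H : Horizon} {ℱ : Filtration ℕ m}
    (hQ : LocallyAbsCont P H ℱ Q) {t : ℕ} (ht : (t : ℕ∞) ∈ H.times) {k : Ω → ℝ}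
    (hk : IsLinf P ℱ t k) : IsLinf Q ℱ t k := by
  obtain ⟨hm, C, hC⟩ := hk
  refine ⟨hm, C, ?_⟩
  have hset : MeasurableSet[ℱ t] {ω | C < |k ω|} :=
    measurableSet_lt measurable_const (continuous_abs.measurable.comp hm)
  have h0 : P {ω | C < |k ω|} = 0 := measure_eq_zero_iff_ae_notMem.2 (by
    filter_upwards [hC] with ω hω using not_lt.2 hω)
  have h1 := hQ t ht ((trim_measurableSet_eq (ℱ.le t) hset).trans h0)
  rw [trim_measurableSet_eq (ℱ.le t) hset] at h1
  filter_upwards [measure_eq_zero_iff_ae_notMem.1 h1] with ω hω using not_lt.1 hω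

/-! ### Discounted sums and conditional expected losses -/

/-- The discounted sum `∑_{s ∈ 𝕋, s ≥ t} γ_s X_s`. -/
noncomputable def discountedSum (H : Horizon) (D : ℕ∞ → Ω → ℝ) (t : ℕ) (X : ℕ∞ → Ω → ℝ) (ω : Ω) :
    ℝ :=
  ∑' s, (timesFrom H t).indicator (fun s => weights H D s ω * X s ω) s

theorem expectedLoss_eq (H : Horizon) (ℱ : Filtration ℕ m) (Q : Measure Ω) (D : ℕ∞ → Ω → ℝ)
    (t : ℕ) (X : ℕ∞ → Ω → ℝ) :
    expectedLoss H ℱ Q D t X = Q[fun ω => -(discountedSum H D t X ω / D t ω) | ℱ t] := by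
  unfold expectedLoss
  congr 1
  funext ω
  rw [discountedSum, ← tsum_subtype, ← tsum_div_const]
  congr 1
  exact tsum_congr fun s => by ring

section Loss

variable {P Q : Measure Ω} {H : Horizon} {ℱ : Filtration ℕ m} {D μ X : ℕ∞ → Ω → ℝ}

theorem ae_hasSum_discountedSum (hD : IsDiscounting P H ℱ Q D)
    (hac : otimes H ℱ Q (weights H D) ≪ otimes H ℱ P μ) (hX : X ∈ Rinf P H ℱ) :
    ∃ C : ℝ, 0 ≤ C ∧ ∀ᵐ ω ∂Q, ∀ t : ℕ, (t : ℕ∞) ∈ H.times →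
      HasSum ((timesFrom H t).indicator fun s => weights H D s ω * X s ω)
        (discountedSum H D t X ω) ∧ |discountedSum H D t X ω| ≤ C * D t ω := by
  obtain ⟨C, hC0, hC⟩ := exists_ae_abs_weights_mul_le hD.measurable_weights
    (hD.hasSum_indicator_weights.mono fun _ h => h.1) hac hX
  refine ⟨C, hC0, ?_⟩
  filter_upwards [hC, hD.hasSum_indicator_weights] with ω h1 h2 t ht
  have hmaj := (h2.2 t ht).mul_left C
  have hle : ∀ s, ‖(timesFrom H t).indicator (fun s => weights H D s ω * X s ω) s‖ ≤
      C * (timesFrom H t).indicator (fun s => weights H D s ω) s := by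
    intro s
    by_cases hs : s ∈ timesFrom H t
    · simpa only [Set.indicator_of_mem hs, Real.norm_eq_abs] using h1 s hs.1
    · simp [Set.indicator_of_notMem hs]
  have hsum : Summable ((timesFrom H t).indicator fun s => weights H D s ω * X s ω) :=
    Summable.of_norm_bounded hmaj.summable hle
  exact ⟨hsum.hasSum, tsum_of_norm_bounded hmaj hle⟩

theorem aemeasurable_discountedSum (hD : IsDiscounting P H ℱ Q D)
    (hac : otimes H ℱ Q (weights H D) ≪ otimes H ℱ P μ) (hX : X ∈ Rinf P H ℱ) {t : ℕ}
    (ht : (t : ℕ∞) ∈ H.times) : AEMeasurable (discountedSum H D t X) Q := by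
  obtain ⟨C, -, hC⟩ := ae_hasSum_discountedSum hD hac hX
  refine aemeasurable_of_tendsto_metrizable_ae atTop
    (f := fun F ω => ∑ s ∈ F, (timesFrom H t).indicator (fun s => weights H D s ω * X s ω) s)
    (fun F => Finset.aemeasurable_fun_sum F fun s _ => ?_)
    (hC.mono fun ω h => (h t ht).1)
  by_cases hs : s ∈ timesFrom H t
  · simp only [Set.indicator_of_mem hs]
    exact ((hD.measurable_weights s hs.1).mul
      ((hX.1 s hs.1).mono (sigmaAt_le ℱ s) le_rfl)).aemeasurable
  · simp only [Set.indicator_of_notMem hs]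
    exact aemeasurable_const

theorem IsDiscounting.ae_mem_Icc (hD : IsDiscounting P H ℱ Q D) {t : ℕ}
    (ht : (t : ℕ∞) ∈ H.times) : ∀ᵐ ω ∂Q, 0 ≤ D t ω ∧ D t ω ≤ 1 := by
  filter_upwards [hD.nonneg, hD.antitone, hD.zero_eq_one] with ω h1 h2 h3
  exact ⟨h1 t ht, h3 ▸ h2 0 (by simpa using mem_times_of_le t.zero_le ht) t ht bot_le⟩

theorem integrable_of_ae_abs_le [IsFiniteMeasure Q] {f : Ω → ℝ} (hf : AEMeasurable f Q) {C : ℝ}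
    (hC : ∀ᵐ ω ∂Q, |f ω| ≤ C) : Integrable f Q :=
  Integrable.of_bound hf.aestronglyMeasurable C hC

theorem integrable_discountedSum [IsFiniteMeasure Q] (hD : IsDiscounting P H ℱ Q D)
    (hac : otimes H ℱ Q (weights H D) ≪ otimes H ℱ P μ) (hX : X ∈ Rinf P H ℱ) {t : ℕ}
    (ht : (t : ℕ∞) ∈ H.times) : Integrable (discountedSum H D t X) Q := by
  obtain ⟨C, hC0, hC⟩ := ae_hasSum_discountedSum hD hac hX
  refine integrable_of_ae_abs_le (aemeasurable_discountedSum hD hac hX ht) (C := C) ?_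
  filter_upwards [hC, hD.ae_mem_Icc ht] with ω h1 h2
  exact (h1 t ht).2.trans (mul_le_of_le_one_right hC0 h2.2)

theorem integrable_discountedSum_div [IsFiniteMeasure Q] (hD : IsDiscounting P H ℱ Q D)
    (hac : otimes H ℱ Q (weights H D) ≪ otimes H ℱ P μ) (hX : X ∈ Rinf P H ℱ) {t : ℕ}
    (ht : (t : ℕ∞) ∈ H.times) :
    Integrable (fun ω => -(discountedSum H D t X ω / D t ω)) Q := by
  obtain ⟨C, hC0, hC⟩ := ae_hasSum_discountedSum hD hac hX
  refine integrable_of_ae_abs_le (((aemeasurable_discountedSum hD hac hX ht).div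
    ((hD.measurable t ht).mono (ℱ.le t) le_rfl).aemeasurable).neg) (C := C) ?_
  filter_upwards [hC, hD.ae_mem_Icc ht] with ω h1 h2
  rw [abs_neg, abs_div, abs_of_nonneg h2.1]
  exact div_le_of_le_mul₀ h2.1 hC0 (h1 t ht).2

theorem mul_expectedLoss_ae_eq [IsFiniteMeasure Q] (hD : IsDiscounting P H ℱ Q D)
    (hac : otimes H ℱ Q (weights H D) ≪ otimes H ℱ P μ) (hX : X ∈ Rinf P H ℱ) {t : ℕ}
    (ht : (t : ℕ∞) ∈ H.times) :
    (fun ω => D t ω * expectedLoss H ℱ Q D t X ω) =ᵐ[Q]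
      Q[fun ω => -discountedSum H D t X ω | ℱ t] := by
  obtain ⟨C, hC0, hC⟩ := ae_hasSum_discountedSum hD hac hX
  have hmul : (D t * fun ω => -(discountedSum H D t X ω / D t ω)) =ᵐ[Q]
      fun ω => -discountedSum H D t X ω := by
    filter_upwards [hC] with ω h
    simp only [Pi.mul_apply, mul_neg, neg_inj]
    by_cases h0 : D t ω = 0
    · have := (h t ht).2
      rw [h0, mul_zero, abs_nonpos_iff] at this
      simp [this]
    · exact mul_div_cancel₀ _ h0
  have hint : Integrable (D t * fun ω => -(discountedSum H D t X ω / D t ω)) Q :=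
    (integrable_congr hmul).2 (integrable_discountedSum hD hac hX ht).neg
  have h := condExp_mul_of_stronglyMeasurable_left (m := ℱ t)
    (hD.measurable t ht).stronglyMeasurable hint (integrable_discountedSum_div hD hac hX ht)
  rw [expectedLoss_eq]
  exact h.symm.trans (condExp_congr_ae hmul)

theorem measurable_expectedLoss (t : ℕ) : Measurable[ℱ t] (expectedLoss H ℱ Q D t X) :=
  stronglyMeasurable_condExp.measurable

theorem expectedLoss_paste_ae_eq [IsFiniteMeasure Q] (hD : IsDiscounting P H ℱ Q D)
    (hac : otimes H ℱ Q (weights H D) ≪ otimes H ℱ P μ) {Y : ℕ∞ → Ω → ℝ}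
    (hX : X ∈ Rinf P H ℱ) (hY : Y ∈ Rinf P H ℱ) {t : ℕ} (ht : (t : ℕ∞) ∈ H.times) {B : Set Ω}
    (hB : MeasurableSet[ℱ t] B) :
    expectedLoss H ℱ Q D t
      (fun s ω => B.indicator 1 ω * X s ω + (1 - B.indicator 1 ω) * Y s ω) =ᵐ[Q]
      B.indicator (expectedLoss H ℱ Q D t X) + Bᶜ.indicator (expectedLoss H ℱ Q D t Y) := by
  have hX' := integrable_discountedSum_div hD hac hX ht
  have hY' := integrable_discountedSum_div hD hac hY ht
  have hsplit : (fun ω => -(discountedSum H D t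
      (fun s ω => B.indicator 1 ω * X s ω + (1 - B.indicator 1 ω) * Y s ω) ω / D t ω)) =
      B.indicator (fun ω => -(discountedSum H D t X ω / D t ω)) +
        Bᶜ.indicator (fun ω => -(discountedSum H D t Y ω / D t ω)) := by
    funext ω
    by_cases h : ω ∈ B <;> simp [h, discountedSum]
  simp only [expectedLoss_eq]
  rw [hsplit]
  exact (condExp_add (hX'.indicator (ℱ.le t _ hB)) (hY'.indicator (ℱ.le t _ hB.compl)) _).trans
    ((condExp_indicator hX' hB).add (condExp_indicator hY' hB.compl))

end Loss

/-! ### Acceptance sets -/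

section Acceptance

variable {P : Measure Ω} {H : Horizon} {ℱ : Filtration ℕ m} {ρ : ℕ → (ℕ∞ → Ω → ℝ) → Ω → ℝ}
  {X Y : ℕ∞ → Ω → ℝ} {t : ℕ}

theorem IsDynamicConvexRiskMeasure.isLinf_evalAt (hρ : IsDynamicConvexRiskMeasure P H ℱ ρ)
    (hX : X ∈ Rinf P H ℱ) (ht : (t : ℕ∞) ∈ H.times) : IsLinf P ℱ t (evalAt ρ t X) :=
  (hρ t ht).mem_Linf _ (proj_mem_RinfFrom t hX)

theorem acceptanceSet_subset_Rinf : acceptanceSet P H ℱ ρ t ⊆ Rinf P H ℱ :=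
  fun _ hX => RinfFrom_subset_Rinf t hX.1

theorem proj_add_mem_acceptanceSet (hρ : IsDynamicConvexRiskMeasure P H ℱ ρ)
    (hX : X ∈ Rinf P H ℱ) (ht : (t : ℕ∞) ∈ H.times) {k : Ω → ℝ} (hk : IsLinf P ℱ t k)
    (hle : evalAt ρ t X ≤ᵐ[P] k) :
    proj t X + proj t (fun _ => k) ∈ acceptanceSet P H ℱ ρ t := by
  refine ⟨RinfFrom_add (proj_mem_RinfFrom t hX) (proj_const_mem_RinfFrom hk), ?_⟩
  filter_upwards [(hρ t ht).cash_invariance _ (proj_mem_RinfFrom t hX) k hk, hle] with ω h1 h2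
  rw [h1]
  exact sub_nonpos.2 h2

theorem isLinf_indicator_one {B : Set Ω} (hB : MeasurableSet[ℱ t] B) :
    IsLinf P ℱ t (B.indicator 1) := by
  refine ⟨Measurable.indicator (m := ℱ t) measurable_const hB, 1, ae_of_all _ fun ω => ?_⟩
  by_cases h : ω ∈ B <;> simp [h]

theorem paste_mem_acceptanceSet (hρ : IsDynamicConvexRiskMeasure P H ℱ ρ)
    (ht : (t : ℕ∞) ∈ H.times) (hX : X ∈ acceptanceSet P H ℱ ρ t)
    (hY : Y ∈ acceptanceSet P H ℱ ρ t) {B : Set Ω} (hB : MeasurableSet[ℱ t] B) :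
    (fun s ω => B.indicator 1 ω * X s ω + (1 - B.indicator 1 ω) * Y s ω) ∈
      acceptanceSet P H ℱ ρ t := by
  have hB1 := isLinf_indicator_one (P := P) hB
  obtain ⟨hXm, C, hC⟩ := acceptanceSet_subset_Rinf hX
  obtain ⟨hYm, K, hK⟩ := acceptanceSet_subset_Rinf hY
  refine ⟨mem_RinfFrom (C := max C K) (fun s hs => ?_) (fun s hs hts => ?_) ?_, ?_⟩
  · funext ω
    simp [eq_zero_of_mem_RinfFrom hX.1 hs, eq_zero_of_mem_RinfFrom hY.1 hs]
  · have hl := hB1.1.mono (filtration_le_sigmaAt ℱ hts) le_rfl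
    exact (hl.mul (hXm s hs)).add ((measurable_const.sub hl).mul (hYm s hs))
  · filter_upwards [hC, hK] with ω h1 h2 s hs _
    by_cases h : ω ∈ B
    · simpa [h] using Or.inl (h1 s hs)
    · simpa [h] using Or.inr (h2 s hs)
  · have h01 : ∀ ω, 0 ≤ B.indicator (1 : Ω → ℝ) ω ∧ B.indicator (1 : Ω → ℝ) ω ≤ 1 := by
      intro ω
      by_cases h : ω ∈ B <;> simp [h]
    filter_upwards [(hρ t ht).convex X hX.1 Y hY.1 _ hB1 (ae_of_all _ h01), hX.2, hY.2]
      with ω h1 h2 h3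
    refine h1.trans ?_
    have := mul_nonpos_of_nonneg_of_nonpos (h01 ω).1 h2
    have := mul_nonpos_of_nonneg_of_nonpos (sub_nonneg.2 (h01 ω).2) h3
    simp only [Pi.zero_apply]
    linarith

/-- The process which pays `X_t` at time `t` and continues with `Y - k` afterwards. -/
noncomputable def restart (t : ℕ) (X Y : ℕ∞ → Ω → ℝ) (k : Ω → ℝ) : ℕ∞ → Ω → ℝ :=
  fun s ω => if s = t then X t ω else (Y + proj (t + 1) (fun _ => -k)) s ω

theorem restart_mem_Rinf (hX : X ∈ Rinf P H ℱ) (hY : Y ∈ Rinf P H ℱ) {k : Ω → ℝ}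
    (hk : IsLinf P ℱ (t + 1) k) : restart t X Y k ∈ Rinf P H ℱ := by
  obtain ⟨hXm, C, hC⟩ := hX
  obtain ⟨hZm, K, hK⟩ := Rinf_add hY (RinfFrom_subset_Rinf _ (proj_const_mem_RinfFrom hk.neg))
  refine ⟨fun s hs => ?_, max C K, ?_⟩
  · by_cases h : s = t
    · have e : restart t X Y k s = X s := by funext ω; simp [restart, h]
      rw [e]; exact hXm _ hs
    · have e : restart t X Y k s = (Y + proj (t + 1) (fun _ => -k)) s := by
        funext ω; simp [restart, h]
      rw [e]; exact hZm s hs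
  · filter_upwards [hC, hK] with ω h1 h2 s hs
    by_cases h : s = t
    · subst h
      simp only [restart, if_true]
      exact (h1 _ hs).trans (le_max_left _ _)
    · simp only [restart, h, if_false]
      exact (h2 _ hs).trans (le_max_right _ _)

theorem proj_restart (hY : Y ∈ RinfFrom P H ℱ (t + 1)) (k : Ω → ℝ) :
    proj (t + 1) (restart t X Y k) = Y + proj (t + 1) (fun _ => -k) := by
  funext s
  by_cases h : ((t + 1 : ℕ) : ℕ∞) ≤ s
  · rw [proj_of_le h]
    have : s ≠ t := by
      rintro rfl
      exact absurd (by exact_mod_cast h) (Nat.not_succ_le_self t)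
    funext ω
    simp [restart, this]
  · simp [proj_of_not_le h, eq_zero_of_mem_RinfFrom hY h]

theorem evalAt_restart_le (hρ : IsDynamicConvexRiskMeasure P H ℱ ρ)
    (hcons : IsTimeConsistent P H ℱ ρ) (ht : ((t + 1 : ℕ) : ℕ∞) ∈ H.times)
    (hX : X ∈ Rinf P H ℱ) (hY : Y ∈ acceptanceSet P H ℱ ρ (t + 1)) :
    evalAt ρ t (restart t X Y (evalAt ρ (t + 1) X)) ≤ᵐ[P] evalAt ρ t X := by
  have hk := hρ.isLinf_evalAt hX ht
  refine hcons t ht _ (restart_mem_Rinf hX (acceptanceSet_subset_Rinf hY) hk) X hX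
    (ae_of_all _ fun ω => by simp [restart]) ?_
  filter_upwards [(hρ _ ht).cash_invariance _ hY.1 _ hk.neg, hY.2] with ω h1 h2
  rw [evalAt, proj_restart hY.1]
  have h3 : ρ (t + 1) (Y + proj (t + 1) fun _ => -evalAt ρ (t + 1) X) ω =
      ρ (t + 1) Y ω + evalAt ρ (t + 1) X ω := by
    rw [h1]; simp
  rw [h3]
  exact add_le_of_nonpos_left h2

end Acceptance

/-! ### The penalized gap process -/

theorem ofReal_integral_le_lintegral {Q : Measure Ω} {f : Ω → ℝ} (hf : Integrable f Q) :
    ENNReal.ofReal (∫ ω, f ω ∂Q) ≤ ∫⁻ ω, ENNReal.ofReal (f ω) ∂Q := by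
  rw [integral_eq_lintegral_pos_part_sub_lintegral_neg_part hf]
  exact (ENNReal.ofReal_le_ofReal (sub_le_self _ ENNReal.toReal_nonneg)).trans
    ENNReal.ofReal_toReal_le

section Gap

variable {P Q : Measure Ω} {H : Horizon} {ℱ : Filtration ℕ m}
  {ρ : ℕ → (ℕ∞ → Ω → ℝ) → Ω → ℝ} {D μ X Y : ℕ∞ → Ω → ℝ} {t : ℕ}

/-- The process `D_t (ρ_t(X) - F_t^{Q,D}(X))`. -/
noncomputable def gap (P : Measure Ω) (H : Horizon) (ℱ : Filtration ℕ m)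
    (ρ : ℕ → (ℕ∞ → Ω → ℝ) → Ω → ℝ) (Q : Measure Ω) (D : ℕ∞ → Ω → ℝ) (X : ℕ∞ → Ω → ℝ) (t : ℕ)
    (ω : Ω) : EReal :=
  (D t ω : EReal) * ((evalAt ρ t X ω : EReal) - riskEvaluation P H ℱ ρ Q D t X ω)

/-- The contribution of an accepted process `Y` to the gap process. -/
noncomputable def gapOf (H : Horizon) (ℱ : Filtration ℕ m)
    (ρ : ℕ → (ℕ∞ → Ω → ℝ) → Ω → ℝ) (Q : Measure Ω) (D : ℕ∞ → Ω → ℝ) (X Y : ℕ∞ → Ω → ℝ) (t : ℕ)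
    (ω : Ω) : ℝ :=
  D t ω * (evalAt ρ t X ω - (expectedLoss H ℱ Q D t X ω - expectedLoss H ℱ Q D t Y ω))

/-- The family of conditional expected losses of accepted processes. -/
def acceptedLosses (P : Measure Ω) (H : Horizon) (ℱ : Filtration ℕ m)
    (ρ : ℕ → (ℕ∞ → Ω → ℝ) → Ω → ℝ) (Q : Measure Ω) (D : ℕ∞ → Ω → ℝ) (t : ℕ) :
    Set (Ω → EReal) :=
  {f | ∃ X ∈ acceptanceSet P H ℱ ρ t, f = fun ω => (expectedLoss H ℱ Q D t X ω : EReal)}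

theorem measurable_of_mem_acceptedLosses {f : Ω → EReal}
    (hf : f ∈ acceptedLosses P H ℱ ρ Q D t) : Measurable[ℱ t] f := by
  obtain ⟨X, -, rfl⟩ := hf
  exact measurable_coe_real_ereal.comp (measurable_expectedLoss t)

theorem isFamilyEssSup_acceptedLosses [IsFiniteMeasure Q] :
    IsFamilyEssSup Q (ℱ t) (acceptedLosses P H ℱ ρ Q D t)
      (familyEssSup Q (ℱ t) (acceptedLosses P H ℱ ρ Q D t)) :=
  isFamilyEssSup_familyEssSup Q (ℱ t) (ℱ.le t) _ fun _ hf => measurable_of_mem_acceptedLosses hf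

theorem penalty_of_pos {ω : Ω} (h : 0 < D t ω) :
    penalty P H ℱ ρ Q D t ω = familyEssSup Q (ℱ t) (acceptedLosses P H ℱ ρ Q D t) ω :=
  if_pos h

theorem measurable_gap [IsFiniteMeasure Q] (hρ : IsDynamicConvexRiskMeasure P H ℱ ρ)
    (hD : IsDiscounting P H ℱ Q D) (hX : X ∈ Rinf P H ℱ) (ht : (t : ℕ∞) ∈ H.times) :
    Measurable[ℱ t] (gap P H ℱ ρ Q D X t) := by
  have hDt := hD.measurable t ht
  have hpen : Measurable[ℱ t] (penalty P H ℱ ρ Q D t) :=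
    Measurable.ite (measurableSet_lt measurable_const hDt) isFamilyEssSup_acceptedLosses.1
      measurable_const
  exact (measurable_coe_real_ereal.comp hDt).mul
    ((measurable_coe_real_ereal.comp (hρ.isLinf_evalAt hX ht).1).sub
      ((measurable_coe_real_ereal.comp (measurable_expectedLoss t)).sub hpen))

theorem coe_gapOf_le_gap [IsFiniteMeasure Q] (hD : IsDiscounting P H ℱ Q D)
    (ht : (t : ℕ∞) ∈ H.times) (hY : Y ∈ acceptanceSet P H ℱ ρ t) :
    ∀ᵐ ω ∂Q, (gapOf H ℱ ρ Q D X Y t ω : EReal) ≤ gap P H ℱ ρ Q D X t ω := by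
  have hsup := (isFamilyEssSup_acceptedLosses (P := P) (ρ := ρ) (D := D) (H := H) (ℱ := ℱ)
    (Q := Q) (t := t)).2.1 _ ⟨Y, hY, rfl⟩
  filter_upwards [hsup, hD.ae_mem_Icc ht] with ω h1 h2
  rcases h2.1.eq_or_lt with h0 | hpos
  · simp [gapOf, gap, ← h0]
  · simp only [gapOf, gap, riskEvaluation, penalty_of_pos hpos, EReal.coe_mul, EReal.coe_sub]
    exact mul_le_mul_of_nonneg_left (EReal.sub_le_sub le_rfl (EReal.sub_le_sub le_rfl h1))
      (by exact_mod_cast h2.1)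

theorem toENNReal_le_iSup_ofReal {d r l : ℝ} (hd : 0 < d) {a : EReal} {b : ℕ → ℝ}
    (hab : a ≤ ⨆ n, (b n : EReal)) :
    ((d : EReal) * ((r : EReal) - ((l : EReal) - a))).toENNReal ≤
      ⨆ n, ENNReal.ofReal (d * (r - (l - b n))) := by
  by_cases htop : (⨆ n, ENNReal.ofReal (d * (r - (l - b n)))) = ⊤
  · rw [htop]; exact le_top
  set B := (⨆ n, ENNReal.ofReal (d * (r - (l - b n)))).toReal with hB
  have hb : ∀ n, b n ≤ B / d - r + l := by
    intro n
    have h1 : d * (r - (l - b n)) ≤ B :=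
      (ENNReal.ofReal_le_iff_le_toReal htop).1
        (le_iSup (fun n => ENNReal.ofReal (d * (r - (l - b n)))) n)
    have h2 := (le_div_iff₀' hd).2 h1
    linarith
  have ha : a ≤ ((B / d - r + l : ℝ) : EReal) :=
    hab.trans (iSup_le fun n => EReal.coe_le_coe_iff.2 (hb n))
  induction a with
  | bot => simp [EReal.coe_mul_bot_of_pos hd]
  | top => exact absurd ha (not_le.2 (EReal.coe_lt_top _))
  | coe x =>
    have hx : x ≤ B / d - r + l := EReal.coe_le_coe_iff.1 ha
    rw [← EReal.coe_sub, ← EReal.coe_sub, ← EReal.coe_mul, EReal.toENNReal_of_ne_top (EReal.coe_ne_top _),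
      EReal.toReal_coe, ENNReal.ofReal_le_iff_le_toReal htop]
    have h1 : r - (l - x) ≤ B / d := by linarith
    exact (le_div_iff₀' hd).1 h1

/-- The random variable whose conditional expectation given `ℱ_t` is `gapOf`. -/
noncomputable def gapIntegrand (H : Horizon) (ρ : ℕ → (ℕ∞ → Ω → ℝ) → Ω → ℝ) (D : ℕ∞ → Ω → ℝ)
    (X Y : ℕ∞ → Ω → ℝ) (t : ℕ) (ω : Ω) : ℝ :=
  D t ω * evalAt ρ t X ω + discountedSum H D t X ω - discountedSum H D t Y ω

theorem integrable_mul_evalAt [IsFiniteMeasure Q] (hQ : LocallyAbsCont P H ℱ Q)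
    (hρ : IsDynamicConvexRiskMeasure P H ℱ ρ) (hD : IsDiscounting P H ℱ Q D)
    (hX : X ∈ Rinf P H ℱ) (ht : (t : ℕ∞) ∈ H.times) :
    Integrable (D t * evalAt ρ t X) Q := by
  obtain ⟨hm, C, hC⟩ := (hρ.isLinf_evalAt hX ht).of_locallyAbsCont hQ ht
  refine integrable_of_ae_abs_le
    (((hD.measurable t ht).mul hm).mono (ℱ.le t) le_rfl).aemeasurable (C := C) ?_
  filter_upwards [hC, hD.ae_mem_Icc ht] with ω h1 h2
  rw [Pi.mul_apply, abs_mul, abs_of_nonneg h2.1]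
  exact (mul_le_of_le_one_left (abs_nonneg _) h2.2).trans h1

theorem integrable_gapIntegrand [IsFiniteMeasure Q] (hQ : LocallyAbsCont P H ℱ Q)
    (hρ : IsDynamicConvexRiskMeasure P H ℱ ρ) (hD : IsDiscounting P H ℱ Q D)
    (hac : otimes H ℱ Q (weights H D) ≪ otimes H ℱ P μ) (hX : X ∈ Rinf P H ℱ)
    (hY : Y ∈ Rinf P H ℱ) (ht : (t : ℕ∞) ∈ H.times) :
    Integrable (gapIntegrand H ρ D X Y t) Q :=
  ((integrable_mul_evalAt hQ hρ hD hX ht).add (integrable_discountedSum hD hac hX ht)).sub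
    (integrable_discountedSum hD hac hY ht)

theorem gapOf_ae_eq_condExp [IsFiniteMeasure Q] (hQ : LocallyAbsCont P H ℱ Q)
    (hρ : IsDynamicConvexRiskMeasure P H ℱ ρ) (hD : IsDiscounting P H ℱ Q D)
    (hac : otimes H ℱ Q (weights H D) ≪ otimes H ℱ P μ) (hX : X ∈ Rinf P H ℱ)
    (hY : Y ∈ Rinf P H ℱ) (ht : (t : ℕ∞) ∈ H.times) :
    gapOf H ℱ ρ Q D X Y t =ᵐ[Q] Q[gapIntegrand H ρ D X Y t | ℱ t] := by
  have hi1 := integrable_mul_evalAt hQ hρ hD hX ht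
  have hi2 := integrable_discountedSum hD hac hX ht
  have hi3 := integrable_discountedSum hD hac hY ht
  have h1 : Q[D t * evalAt ρ t X | ℱ t] = D t * evalAt ρ t X :=
    condExp_of_stronglyMeasurable (ℱ.le t)
      ((hD.measurable t ht).mul (hρ.isLinf_evalAt hX ht).1).stronglyMeasurable hi1
  have h2 := condExp_sub (m := ℱ t) (hi1.add hi2) hi3
  have h3 := condExp_add (m := ℱ t) hi1 hi2
  have h4 := condExp_neg (μ := Q) (discountedSum H D t X) (ℱ t)
  have h5 := condExp_neg (μ := Q) (discountedSum H D t Y) (ℱ t)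
  filter_upwards [h2, h3, h4, h5, mul_expectedLoss_ae_eq hD hac hX ht,
    mul_expectedLoss_ae_eq hD hac hY ht] with ω e2 e3 e4 e5 e6 e7
  have e8 : (Q[gapIntegrand H ρ D X Y t | ℱ t]) ω =
    (Q[D t * evalAt ρ t X + discountedSum H D t X - discountedSum H D t Y | ℱ t]) ω := rfl
  change _ = (Q[-discountedSum H D t X | ℱ t]) ω at e6
  change _ = (Q[-discountedSum H D t Y | ℱ t]) ω at e7
  rw [e8, e2, Pi.sub_apply, e3, Pi.add_apply, h1, Pi.mul_apply]
  rw [e4, Pi.neg_apply] at e6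
  rw [e5, Pi.neg_apply] at e7
  rw [gapOf]
  linear_combination -e6 + e7

theorem gapOf_self_ae_eq_zero [IsFiniteMeasure Q] (hQ : LocallyAbsCont P H ℱ Q)
    (hρ : IsDynamicConvexRiskMeasure P H ℱ ρ) (hD : IsDiscounting P H ℱ Q D)
    (hac : otimes H ℱ Q (weights H D) ≪ otimes H ℱ P μ) (hX : X ∈ Rinf P H ℱ)
    (ht : (t : ℕ∞) ∈ H.times) :
    gapOf H ℱ ρ Q D X (proj t X + proj t (fun _ => evalAt ρ t X)) t =ᵐ[Q] 0 := by
  have hY : proj t X + proj t (fun _ => evalAt ρ t X) ∈ Rinf P H ℱ :=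
    RinfFrom_subset_Rinf t (RinfFrom_add (proj_mem_RinfFrom t hX)
      (proj_const_mem_RinfFrom (hρ.isLinf_evalAt hX ht)))
  have h0 : gapIntegrand H ρ D X (proj t X + proj t (fun _ => evalAt ρ t X)) t =ᵐ[Q] 0 := by
    obtain ⟨_, -, h1⟩ := ae_hasSum_discountedSum hD hac hX
    obtain ⟨_, -, h2⟩ := ae_hasSum_discountedSum hD hac hY
    filter_upwards [h1, h2, hD.hasSum_indicator_weights] with ω e1 e2 e3
    have hs := (((e3.2 t ht).mul_right (evalAt ρ t X ω)).add (e1 t ht).1).sub (e2 t ht).1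
    refine hs.unique ?_
    convert! hasSum_zero (α := ℝ) (β := ℕ∞) using 2 with s
    by_cases h : s ∈ timesFrom H t
    · simp only [Set.indicator_of_mem h, Pi.add_apply, proj_of_le h.2]
      ring
    · simp [Set.indicator_of_notMem h]
  refine (gapOf_ae_eq_condExp hQ hρ hD hac hX hY ht).trans ?_
  refine (condExp_congr_ae h0).trans ?_
  rw [condExp_zero]

theorem exists_monotone_seq_gapOf [IsFiniteMeasure Q] (hQ : LocallyAbsCont P H ℱ Q)
    (hρ : IsDynamicConvexRiskMeasure P H ℱ ρ) (hD : IsDiscounting P H ℱ Q D)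
    (hac : otimes H ℱ Q (weights H D) ≪ otimes H ℱ P μ) (hX : X ∈ Rinf P H ℱ)
    (ht : (t : ℕ∞) ∈ H.times) :
    ∃ Y : ℕ → ℕ∞ → Ω → ℝ, (∀ n, Y n ∈ acceptanceSet P H ℱ ρ t) ∧
      (∀ n, 0 ≤ᵐ[Q] gapOf H ℱ ρ Q D X (Y n) t) ∧
      (∀ n, gapOf H ℱ ρ Q D X (Y n) t ≤ᵐ[Q] gapOf H ℱ ρ Q D X (Y (n + 1)) t) ∧
      ∀ᵐ ω ∂Q, (gap P H ℱ ρ Q D X t ω).toENNReal ≤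
        ⨆ n, ENNReal.ofReal (gapOf H ℱ ρ Q D X (Y n) t ω) := by
  set S := acceptedLosses P H ℱ ρ Q D t with hS
  set Y₀ := proj t X + proj t (fun _ => evalAt ρ t X) with hY₀
  have hY₀mem : Y₀ ∈ acceptanceSet P H ℱ ρ t :=
    proj_add_mem_acceptanceSet hρ hX ht (hρ.isLinf_evalAt hX ht) EventuallyLE.rfl
  obtain ⟨C, hCc, hCS, hC⟩ := exists_countable_ae_le_iSup Q S fun f hf =>
    (measurable_of_mem_acceptedLosses hf).mono (ℱ.le t) le_rfl
  obtain ⟨f, hf⟩ := (hCc.insert (fun ω => (expectedLoss H ℱ Q D t Y₀ ω : EReal))).exists_eq_range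
    (Set.insert_nonempty _ _)
  have hfS : ∀ n, f n ∈ S := fun n =>
    by
    have h : f n ∈ insert _ C := hf ▸ Set.mem_range_self n
    exact Set.insert_subset (show _ ∈ S from ⟨Y₀, hY₀mem, rfl⟩) hCS h
  choose Z hZ hfZ using hfS
  have step : ∀ (Y : acceptanceSet P H ℱ ρ t) (n : ℕ), ∃ Y' : acceptanceSet P H ℱ ρ t,
      ∀ᵐ ω ∂Q, expectedLoss H ℱ Q D t Y ω ≤ expectedLoss H ℱ Q D t Y' ω ∧
        expectedLoss H ℱ Q D t (Z n) ω ≤ expectedLoss H ℱ Q D t Y' ω := by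
    rintro ⟨Y, hY⟩ n
    have hB : MeasurableSet[ℱ t]
        {ω | expectedLoss H ℱ Q D t (Z n) ω ≤ expectedLoss H ℱ Q D t Y ω} :=
      measurableSet_le (measurable_expectedLoss t) (measurable_expectedLoss t)
    refine ⟨⟨_, paste_mem_acceptanceSet hρ ht hY (hZ n) hB⟩, ?_⟩
    filter_upwards [expectedLoss_paste_ae_eq hD hac (acceptanceSet_subset_Rinf hY)
      (acceptanceSet_subset_Rinf (hZ n)) ht hB] with ω hω
    rw [hω]
    by_cases h : expectedLoss H ℱ Q D t (Z n) ω ≤ expectedLoss H ℱ Q D t Y ω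
    · simp [h]
    · simp [h, (not_le.1 h).le]
  choose next hnext using step
  let Y : ℕ → acceptanceSet P H ℱ ρ t := fun n =>
    Nat.rec ⟨Y₀, hY₀mem⟩ (fun n Y => next Y n) n
  have hY : ∀ n, ∀ᵐ ω ∂Q, expectedLoss H ℱ Q D t (Y n).1 ω ≤ expectedLoss H ℱ Q D t (Y (n + 1)).1 ω ∧
      expectedLoss H ℱ Q D t (Z n) ω ≤ expectedLoss H ℱ Q D t (Y (n + 1)).1 ω :=
    fun n => hnext (Y n) n
  have hmono : ∀ n, gapOf H ℱ ρ Q D X (Y n).1 t ≤ᵐ[Q] gapOf H ℱ ρ Q D X (Y (n + 1)).1 t := by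
    intro n
    filter_upwards [hY n, hD.ae_mem_Icc ht] with ω h1 h2
    exact mul_le_mul_of_nonneg_left (sub_le_sub_left (sub_le_sub_left h1.1 _) _) h2.1
  refine ⟨fun n => (Y n).1, fun n => (Y n).2, fun n => ?_, hmono, ?_⟩
  · induction n with
    | zero => exact (gapOf_self_ae_eq_zero hQ hρ hD hac hX ht).symm.le
    | succ n ih => exact ih.trans (hmono n)
  · have hmeas : Measurable[ℱ t] fun ω => ⨆ n, f n ω :=
      Measurable.iSup fun n => by
        rw [hfZ n]; exact measurable_coe_real_ereal.comp (measurable_expectedLoss t)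
    have hsup := isFamilyEssSup_acceptedLosses.2.2 _ hmeas fun g hg => by
      filter_upwards [hC g hg] with ω hω
      refine hω.trans (iSup₂_le fun k hk => ?_)
      obtain ⟨n, rfl⟩ : k ∈ Set.range f := hf ▸ Set.mem_insert_of_mem _ hk
      exact le_iSup (fun n => f n ω) n
    filter_upwards [hsup, ae_all_iff.2 hY, hD.ae_mem_Icc ht] with ω h1 h2 h3
    rcases h3.1.eq_or_lt with h0 | hpos
    · simp [gap, ← h0]
    · simp only [gap, gapOf, riskEvaluation, penalty_of_pos hpos]
      refine toENNReal_le_iSup_ofReal hpos (h1.trans (iSup_le fun n => ?_))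
      rw [hfZ n]
      exact le_iSup_of_le (n + 1) (EReal.coe_le_coe_iff.2 (h2 n).2)

theorem gapIntegrand_restart_ae_eq (hρ : IsDynamicConvexRiskMeasure P H ℱ ρ)
    (hD : IsDiscounting P H ℱ Q D)
    (hac : otimes H ℱ Q (weights H D) ≪ otimes H ℱ P μ) (hX : X ∈ Rinf P H ℱ)
    (ht : ((t + 1 : ℕ) : ℕ∞) ∈ H.times) (hY : Y ∈ Rinf P H ℱ) :
    gapIntegrand H ρ D X (proj t (restart t X Y (evalAt ρ (t + 1) X)) +
      proj t (fun _ => evalAt ρ t X)) t =ᵐ[Q] gapIntegrand H ρ D X Y (t + 1) := by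
  have ht' := mem_times_of_le t.le_succ ht
  have hk := hρ.isLinf_evalAt hX ht
  have hZ : proj t (restart t X Y (evalAt ρ (t + 1) X)) + proj t (fun _ => evalAt ρ t X) ∈
      Rinf P H ℱ :=
    RinfFrom_subset_Rinf t (RinfFrom_add (proj_mem_RinfFrom t (restart_mem_Rinf hX hY hk))
      (proj_const_mem_RinfFrom (hρ.isLinf_evalAt hX ht')))
  obtain ⟨_, -, h1⟩ := ae_hasSum_discountedSum hD hac hX
  obtain ⟨_, -, h2⟩ := ae_hasSum_discountedSum hD hac hY
  obtain ⟨_, -, h3⟩ := ae_hasSum_discountedSum hD hac hZ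
  filter_upwards [h1, h2, h3, hD.hasSum_indicator_weights] with ω e1 e2 e3 e4
  have hl := (((e4.2 t ht').mul_right (evalAt ρ t X ω)).add (e1 t ht').1).sub (e3 t ht').1
  have hr := (((e4.2 _ ht).mul_right (evalAt ρ (t + 1) X ω)).add (e1 _ ht).1).sub (e2 _ ht).1
  refine hl.unique ?_
  convert! hr using 2 with s
  by_cases h : s ∈ timesFrom H (t + 1)
  · have hts : (t : ℕ∞) ≤ s := le_trans (by exact_mod_cast t.le_succ) h.2
    have hne : s ≠ t := by
      rintro rfl
      exact absurd (by exact_mod_cast h.2) (Nat.not_succ_le_self t)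
    have h' : s ∈ timesFrom H t := ⟨h.1, hts⟩
    simp only [Set.indicator_of_mem h, Set.indicator_of_mem h', Pi.add_apply, proj_of_le hts,
      restart, hne, if_false, proj_of_le h.2, Pi.neg_apply]
    ring
  · rw [Set.indicator_of_notMem h, Set.indicator_of_notMem h, Set.indicator_of_notMem h]
    by_cases h' : s ∈ timesFrom H t
    · have hst : s = t := by
        by_contra hne
        have hlt := lt_of_le_of_ne h'.2 (Ne.symm hne)
        exact h ⟨h'.1, by push_cast; exact Order.add_one_le_of_lt hlt⟩
      subst hst
      simp only [Set.indicator_of_mem h', Pi.add_apply, proj_of_le le_rfl, restart, if_true]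
      ring
    · simp [Set.indicator_of_notMem h']

theorem setLIntegral_gap_succ_le [IsFiniteMeasure Q] (hQ : LocallyAbsCont P H ℱ Q)
    (hρ : IsDynamicConvexRiskMeasure P H ℱ ρ) (hcons : IsTimeConsistent P H ℱ ρ)
    (hD : IsDiscounting P H ℱ Q D)
    (hac : otimes H ℱ Q (weights H D) ≪ otimes H ℱ P μ) (hX : X ∈ Rinf P H ℱ)
    (ht : ((t + 1 : ℕ) : ℕ∞) ∈ H.times) {A : Set Ω} (hA : MeasurableSet[ℱ t] A) :
    ∫⁻ ω in A, (gap P H ℱ ρ Q D X (t + 1) ω).toENNReal ∂Q ≤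
      ∫⁻ ω in A, (gap P H ℱ ρ Q D X t ω).toENNReal ∂Q := by
  have ht' := mem_times_of_le t.le_succ ht
  obtain ⟨Y, hY, hpos, hmono, hsup⟩ := exists_monotone_seq_gapOf hQ hρ hD hac hX ht
  have hgm : ∀ n, AEMeasurable (gapOf H ℱ ρ Q D X (Y n) (t + 1)) Q := fun n =>
    (stronglyMeasurable_condExp.mono (ℱ.le _)).measurable.aemeasurable.congr
      (gapOf_ae_eq_condExp hQ hρ hD hac hX (acceptanceSet_subset_Rinf (hY n)) ht).symm
  refine (lintegral_mono_ae (ae_restrict_of_ae hsup)).trans ?_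
  rw [lintegral_iSup' (fun n => (hgm n).restrict.ennreal_ofReal)]
  swap
  · refine ae_restrict_of_ae ?_
    filter_upwards [ae_all_iff.2 hmono] with ω hω
    exact monotone_nat_of_le_succ fun n => ENNReal.ofReal_le_ofReal (hω n)
  refine iSup_le fun n => ?_
  set k := evalAt ρ (t + 1) X
  set Z := proj t (restart t X (Y n) k) + proj t (fun _ => evalAt ρ t X) with hZ
  have hYn := acceptanceSet_subset_Rinf (hY n)
  have hZmem : Z ∈ acceptanceSet P H ℱ ρ t :=
    proj_add_mem_acceptanceSet hρ (restart_mem_Rinf hX hYn (hρ.isLinf_evalAt hX ht)) ht'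
      (hρ.isLinf_evalAt hX ht') (evalAt_restart_le hρ hcons ht hX (hY n))
  have hZR := acceptanceSet_subset_Rinf hZmem
  have hc1 := gapOf_ae_eq_condExp hQ hρ hD hac hX hYn ht
  have hc2 := gapOf_ae_eq_condExp hQ hρ hD hac hX hZR ht'
  have hint1 : Integrable (gapOf H ℱ ρ Q D X (Y n) (t + 1)) Q :=
    integrable_condExp.congr hc1.symm
  have hint2 : Integrable (gapOf H ℱ ρ Q D X Z t) Q := integrable_condExp.congr hc2.symm
  have heq : ∫ ω in A, gapOf H ℱ ρ Q D X (Y n) (t + 1) ω ∂Q =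
      ∫ ω in A, gapOf H ℱ ρ Q D X Z t ω ∂Q := by
    rw [integral_congr_ae (ae_restrict_of_ae hc1), integral_congr_ae (ae_restrict_of_ae hc2),
      setIntegral_condExp (ℱ.le _) (integrable_gapIntegrand hQ hρ hD hac hX hYn ht)
        (ℱ.mono t.le_succ _ hA),
      setIntegral_condExp (ℱ.le _) (integrable_gapIntegrand hQ hρ hD hac hX hZR ht') hA]
    exact integral_congr_ae (ae_restrict_of_ae
      (gapIntegrand_restart_ae_eq hρ hD hac hX ht hYn).symm)
  rw [← ofReal_integral_eq_lintegral_ofReal hint1.integrableOn (ae_restrict_of_ae (hpos n)), heq]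
  refine (ofReal_integral_le_lintegral hint2.integrableOn).trans
    (lintegral_mono_ae (ae_restrict_of_ae ?_))
  filter_upwards [coe_gapOf_le_gap (X := X) hD ht' hZmem] with ω hω
  simpa using EReal.toENNReal_le_toENNReal hω

theorem gap_nonneg [IsFiniteMeasure Q] (hQ : LocallyAbsCont P H ℱ Q)
    (hρ : IsDynamicConvexRiskMeasure P H ℱ ρ) (hD : IsDiscounting P H ℱ Q D)
    (hac : otimes H ℱ Q (weights H D) ≪ otimes H ℱ P μ) (hX : X ∈ Rinf P H ℱ)
    (ht : (t : ℕ∞) ∈ H.times) : ∀ᵐ ω ∂Q, 0 ≤ gap P H ℱ ρ Q D X t ω := by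
  have hY := proj_add_mem_acceptanceSet hρ hX ht (hρ.isLinf_evalAt hX ht) EventuallyLE.rfl
  filter_upwards [coe_gapOf_le_gap (X := X) hD ht hY, gapOf_self_ae_eq_zero hQ hρ hD hac hX ht]
    with ω h1 h2
  rw [h2] at h1
  simpa using h1

end Gap

end RiskProc

theorem mainTheorem7 {Ω : Type*} {m : MeasurableSpace Ω}
    (P : Measure Ω) [IsProbabilityMeasure P]
    (H : RiskProc.Horizon) (ℱ : Filtration ℕ m) (hℱ : ℱ 0 = ⊥)
    (μ : ℕ∞ → Ω → ℝ) (hμ : RiskProc.IsReference P H ℱ μ)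
    (ρ : ℕ → (ℕ∞ → Ω → ℝ) → Ω → ℝ)
    (hρ : RiskProc.IsDynamicConvexRiskMeasure P H ℱ ρ)
    (hρ_cons : RiskProc.IsTimeConsistent P H ℱ ρ)
    (hρ_cont : RiskProc.IsContinuousFromAbove P H ℱ ρ)
    (Q : Measure Ω) [IsProbabilityMeasure Q] (hQ : RiskProc.LocallyAbsCont P H ℱ Q)
    (D : ℕ∞ → Ω → ℝ) (hD : RiskProc.IsDiscounting P H ℱ Q D)
    (hQD : RiskProc.otimes H ℱ Q (RiskProc.weights H D) ∈ RiskProc.absContModels P H ℱ μ)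
    (X : ℕ∞ → Ω → ℝ) (hX : X ∈ RiskProc.Rinf P H ℱ) (c : ℝ) (hc : 0 < c) :
    ∀ᵐ ω₀ ∂Q,
      ((Q {ω | (c : EReal) ≤ ⨆ (t : ℕ) (_ : (t : ℕ∞) ∈ H.times),
          (D t ω : EReal) * ((RiskProc.evalAt ρ t X ω : EReal) -
            RiskProc.riskEvaluation P H ℱ ρ Q D t X ω)} : ℝ≥0∞) : EReal) ≤
        ((RiskProc.evalAt ρ 0 X ω₀ : EReal) -
          RiskProc.riskEvaluation P H ℱ ρ Q D 0 X ω₀) / (c : EReal) := by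
  classical
  have h0 : ((0 : ℕ) : ℕ∞) ∈ H.times := by cases H <;> simp [RiskProc.Horizon.times]
  let V := RiskProc.gap P H ℱ ρ Q D X
  set W : ℕ → Ω → ℝ≥0∞ := fun t ω => if (t : ℕ∞) ∈ H.times then (V t ω).toENNReal else 0 with hW
  have hWmeas : ∀ t, Measurable[ℱ t] (W t) := by
    intro t
    by_cases ht : (t : ℕ∞) ∈ H.times
    · simp only [hW, ht, if_true]
      exact measurable_ereal_toENNReal.comp (RiskProc.measurable_gap hρ hD hX ht)
    · simp only [hW, ht, if_false]
      exact measurable_const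
  have hWsuper : ∀ t A, MeasurableSet[ℱ t] A →
      ∫⁻ ω in A, W (t + 1) ω ∂Q ≤ ∫⁻ ω in A, W t ω ∂Q := by
    intro t A hA
    by_cases ht : ((t + 1 : ℕ) : ℕ∞) ∈ H.times
    · simp only [hW, ht, RiskProc.mem_times_of_le t.le_succ ht, if_true]
      exact RiskProc.setLIntegral_gap_succ_le hQ hρ hρ_cons hD hQD.2 hX ht hA
    · simp only [hW, ht, if_false, lintegral_zero, zero_le]
  have hdoob := RiskProc.mul_measure_iSup_ge_le Q ℱ hWmeas hWsuper (ENNReal.ofReal c)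
  set E := {ω | (c : EReal) ≤ ⨆ (t : ℕ) (_ : (t : ℕ∞) ∈ H.times), V t ω} with hE
  have hsub : E ⊆ {ω | ENNReal.ofReal c ≤ ⨆ t, W t ω} := by
    intro ω hω
    have hle : (⨆ (t : ℕ) (_ : (t : ℕ∞) ∈ H.times), V t ω) ≤ ((⨆ t, W t ω : ℝ≥0∞) : EReal) := by
      refine iSup₂_le fun t ht => (le_max_right 0 _).trans ?_
      rw [← EReal.coe_toENNReal_eq_max]
      refine EReal.coe_ennreal_le_coe_ennreal_iff.2 (le_iSup_of_le t ?_)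
      simp [hW, ht]
    have hcW := (show (c : EReal) ≤ _ from hω).trans hle
    simpa using EReal.toENNReal_le_toENNReal hcW
  obtain ⟨w, hw⟩ : ∃ w, W 0 = fun _ => w := by
    have h := hWmeas 0
    rw [hℱ] at h
    exact eq_const_of_measurable_bot h
  have hbound : ENNReal.ofReal c * Q E ≤ w := by
    refine (mul_le_mul_right (measure_mono hsub) _).trans (hdoob.trans ?_)
    simp [hw]
  filter_upwards [RiskProc.gap_nonneg hQ hρ hD hQD.2 hX h0, hD.zero_eq_one] with ω₀ hpos hD0
  have hVw : ((RiskProc.evalAt ρ 0 X ω₀ : EReal) -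
      RiskProc.riskEvaluation P H ℱ ρ Q D 0 X ω₀) = w := by
    have h1 : W 0 ω₀ = w := by rw [hw]
    have h2 : W 0 ω₀ = (V 0 ω₀).toENNReal := by simp only [hW, h0, if_true]
    rw [← h1, h2, EReal.coe_toENNReal hpos]
    change _ = RiskProc.gap P H ℱ ρ Q D X 0 ω₀
    simp [RiskProc.gap, hD0]
  rw [hVw, EReal.le_div_iff_mul_le (by exact_mod_cast hc) (by simp)]
  have hcast : (c : EReal) = ((ENNReal.ofReal c : ℝ≥0∞) : EReal) := by
    simp [EReal.coe_ennreal_ofReal, hc.le]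
  have hfinal : (c : EReal) * (Q E : EReal) ≤ w := by
    rw [hcast, ← EReal.coe_ennreal_mul]
    exact EReal.coe_ennreal_le_coe_ennreal_iff.2 hbound
  rw [mul_comm]
  exact hfinal
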